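/- Let $K$ be an algebraically closed field of characteristic zero and let $H$ be a finite dimensional Hopf algebra over $K$ that is semisimple as an algebra, with comultiplication $\Delta$ (Sweedler notation $\Delta(x)=x_1\otimes x_2$), counit $\epsilon$ and antipode $S$. The dual $H^*$ is a Hopf algebra, with the transposed structure maps. Let $\lambda\in H^*$ be the character of the regular representation of $H$, and let $\ell\in H=H^{**}$ be the character of the regular representation of $H^*$. Put $$c_H^1=\ell^1_1\,\ell^2_1\,S(\ell^1_2)\,S(\ell^2_2)\in H,$$ where $\ell^1,\ell^2$ are two copies of $\ell$, and let $c_{H^*}^1\in H^*$ be the element defined in the same way from the Hopf algebra $H^*$ (so with $\lambda$ in place of $\ell$). A basic invariant of $H$ is a scalar obtained as follows: start with $\ell^{\otimes a}\otimes\lambda^{\otimes b}$ for some $a,b\ge 0$; apply the comultiplications of $H$ and of $H^*$ repeatedly to tensor factors until an element of $H^{\otimes n}\otimes(H^*)^{\otimes n}$ is reached; permute the $n$ factors in $H$ and the $n$ factors in $H^*$; pair the $i$-th factor in $H$ with the $i$-th factor in $H^*$ for $i=1,\dots,n$. Then: 1. $\ell$ is the unique left integral of $H$ with $\epsilon(\ell)=\dim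 H$, that is, the unique $x\in H$ with $yx=\epsilon(y)x$ for all $y\in H$ and $\epsilon(x)=\dim H$. Likewise $\lambda$ is the unique left integral of $H^*$ with $\lambda(1)=\dim H$. 2. If $W_1,\dots,W_r$ are the irreducible representations of $H$ up to isomorphism and $e_i\in H$ is the element acting as the identity on $W_i$ and as zero on $W_j$ for $j\ne i$, then $$c_H^1=\sum_{i=1}^r\left(\frac{\dim H}{\dim W_i}\right)^2e_i ,$$ and the same formula holds for $H^*$ in place of $H$. 3. If $\lambda\big((c_H^1)^n\big)\in\mathbb Z$ for all $n\ge 0$, then $\dim W$ divides $\dim H$ for every irreducible representation $W$ of $H$. Likewise for $H^*$: if $\ell\big((c_{H^*}^1)^n\big)\in\mathbb Z$ for all $n\ge 0$, where $\ell$ is viewed as a linear form on $H^*$, then $\dim V$ divides $\dim H$ for every irreducible representation $V$ of $H^*$. 4. If all basic invariants of $H$ are algebraic integers, then $H$ satisfies Kaplansky's sixth conjecture: $\dim W$ divides $\dim H$ for every irreducible representation $W$ of $H$, and $\dim V$ divides $\dim H$ for every irreducible representation $V$ of $H^*$. -/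

import Mathlib

open scoped TensorProduct

universe u v w

noncomputable section

/-- The linear dual `H^*` of a coalgebra `H`, with the convolution product
`(f * g)(x) = f(x₁) g(x₂)` as multiplication, that is, the transpose of the comultiplication
of `H`. -/
def HopfDual (K : Type u) (H : Type v) [Field K] [Ring H] [HopfAlgebra K H] : Type (max u v) :=
  WithConv (H →ₗ[K] K)

namespace HopfDual

section Structure

variable (K : Type u) (H : Type v) [Field K] [Ring H] [HopfAlgebra K H]

instance instRing : Ring (HopfDual K H) :=
  inferInstanceAs (Ring (WithConv (H →ₗ[K] K)))

instance instAlgebra : Algebra K (HopfDual K H) :=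
  inferInstanceAs (Algebra K (WithConv (H →ₗ[K] K)))

/-- The identity map from `H^*` with its algebra structure to the plain dual vector space. -/
def toDual : HopfDual K H ≃ₗ[K] Module.Dual K H where
  toFun f := WithConv.ofConv f
  invFun f := WithConv.toConv f
  left_inv _ := rfl
  right_inv _ := rfl
  map_add' _ _ := rfl
  map_smul' _ _ := rfl

instance instCoeFun : CoeFun (HopfDual K H) (fun _ => H → K) where
  coe f := toDual K H f

instance instFinite [FiniteDimensional K H] : FiniteDimensional K (HopfDual K H) :=
  Module.Finite.equiv (toDual K H).symm

/-- The counit of `H^*`: evaluation at the unit of `H`. -/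
def counitMap : HopfDual K H →ₗ[K] K :=
  (Module.Dual.eval K H 1) ∘ₗ (toDual K H).toLinearMap

/-- The antipode of `H^*`: the transpose of the antipode of `H`. -/
def antipodeMap : HopfDual K H →ₗ[K] HopfDual K H :=
  (toDual K H).symm.toLinearMap ∘ₗ
    (HopfAlgebra.antipode K (A := H)).dualMap ∘ₗ
      (toDual K H).toLinearMap

variable [FiniteDimensional K H]

/-- The identification `H^* ⊗ H^* ≃ (H ⊗ H)^*`. -/
def pairEquiv : HopfDual K H ⊗[K] HopfDual K H ≃ₗ[K] Module.Dual K (H ⊗[K] H) :=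
  (TensorProduct.congr (toDual K H) (toDual K H)).trans (TensorProduct.dualDistribEquiv K H H)

/-- The comultiplication of `H^*`: the transpose of the multiplication of `H`. -/
def comulMap : HopfDual K H →ₗ[K] HopfDual K H ⊗[K] HopfDual K H :=
  (pairEquiv K H).symm.toLinearMap ∘ₗ (LinearMap.mul' K H).dualMap ∘ₗ
    (toDual K H).toLinearMap

end Structure

section Laws

variable {K : Type u} {H : Type v} [Field K] [Ring H] [HopfAlgebra K H]

@[ext]
lemma ext {f g : HopfDual K H} (h : ∀ x, f x = g x) : f = g :=
  (toDual K H).injective (LinearMap.ext h)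

lemma mul_apply (f g : HopfDual K H) (x : H) :
    (f * g) x = LinearMap.mul' K K
      (TensorProduct.map (toDual K H f) (toDual K H g) (Coalgebra.comul x)) := rfl

lemma one_apply (x : H) : (1 : HopfDual K H) x = Coalgebra.counit (R := K) x := rfl

lemma algebraMap_apply (c : K) (x : H) :
    (algebraMap K (HopfDual K H) c) x = c * Coalgebra.counit (R := K) x := rfl

lemma counitMap_apply (f : HopfDual K H) : counitMap K H f = f 1 := rfl

lemma antipodeMap_apply (f : HopfDual K H) (x : H) :
    antipodeMap K H f x = f (HopfAlgebra.antipode K x) := rfl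

variable [FiniteDimensional K H]

lemma pairEquiv_tmul (f g : HopfDual K H) (x y : H) :
    pairEquiv K H (f ⊗ₜ g) (x ⊗ₜ y) = f x * g y := rfl

lemma pairEquiv_comulMap (f : HopfDual K H) (t : H ⊗[K] H) :
    pairEquiv K H (comulMap K H f) t = f (LinearMap.mul' K H t) := by
  simp [comulMap]

/-- The identification `H^* ⊗ (H^* ⊗ H^*) ≃ (H ⊗ (H ⊗ H))^*`. -/
def tripleEquiv : HopfDual K H ⊗[K] (HopfDual K H ⊗[K] HopfDual K H) ≃ₗ[K]
    Module.Dual K (H ⊗[K] (H ⊗[K] H)) :=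
  (TensorProduct.congr (toDual K H) (pairEquiv K H)).trans
    (TensorProduct.dualDistribEquiv K H (H ⊗[K] H))

lemma tripleEquiv_tmul (f : HopfDual K H) (s : HopfDual K H ⊗[K] HopfDual K H) (x : H)
    (t : H ⊗[K] H) : tripleEquiv (f ⊗ₜ s) (x ⊗ₜ t) = f x * pairEquiv K H s t := rfl

lemma tripleEquiv_lTensor (s : HopfDual K H ⊗[K] HopfDual K H) (x y z : H) :
    tripleEquiv ((comulMap K H).lTensor (HopfDual K H) s) (x ⊗ₜ (y ⊗ₜ z)) =
      pairEquiv K H s (x ⊗ₜ (y * z)) := by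
  induction s with
  | zero => simp
  | add a b ha hb => simp only [map_add, LinearMap.add_apply, ha, hb]
  | tmul f g =>
    rw [LinearMap.lTensor_tmul, tripleEquiv_tmul, pairEquiv_comulMap, pairEquiv_tmul]; simp

lemma tripleEquiv_assoc (s : HopfDual K H ⊗[K] HopfDual K H) (g : HopfDual K H) (x y z : H) :
    tripleEquiv (TensorProduct.assoc K _ _ _ (s ⊗ₜ g)) (x ⊗ₜ (y ⊗ₜ z)) =
      pairEquiv K H s (x ⊗ₜ y) * g z := by
  induction s with
  | zero => simp
  | add a b ha hb =>
    simp only [TensorProduct.add_tmul, map_add, LinearMap.add_apply, ha, hb, add_mul]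
  | tmul f h =>
    rw [TensorProduct.assoc_tmul, tripleEquiv_tmul, pairEquiv_tmul, pairEquiv_tmul, mul_assoc]

lemma tripleEquiv_rTensor (s : HopfDual K H ⊗[K] HopfDual K H) (x y z : H) :
    tripleEquiv (TensorProduct.assoc K _ _ _ ((comulMap K H).rTensor (HopfDual K H) s))
      (x ⊗ₜ (y ⊗ₜ z)) = pairEquiv K H s ((x * y) ⊗ₜ z) := by
  induction s with
  | zero => simp
  | add a b ha hb => simp only [map_add, LinearMap.add_apply, ha, hb]
  | tmul f g =>
    rw [LinearMap.rTensor_tmul, tripleEquiv_assoc, pairEquiv_comulMap, pairEquiv_tmul]; simp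

lemma rTensor_counitMap (s : HopfDual K H ⊗[K] HopfDual K H) (x : H) :
    (TensorProduct.lid K _ ((counitMap K H).rTensor (HopfDual K H) s)) x =
      pairEquiv K H s (1 ⊗ₜ x) := by
  induction s with
  | zero => simp
  | add a b ha hb =>
    simp only [map_add, LinearMap.add_apply, ha, hb]
  | tmul f g => simp [pairEquiv_tmul, counitMap_apply]

lemma lTensor_counitMap (s : HopfDual K H ⊗[K] HopfDual K H) (x : H) :
    (TensorProduct.rid K _ ((counitMap K H).lTensor (HopfDual K H) s)) x =
      pairEquiv K H s (x ⊗ₜ 1) := by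
  induction s with
  | zero => simp
  | add a b ha hb =>
    simp only [map_add, LinearMap.add_apply, ha, hb]
  | tmul f g => simp [pairEquiv_tmul, counitMap_apply, mul_comm]

instance instCoalgebra : Coalgebra K (HopfDual K H) where
  comul := comulMap K H
  counit := counitMap K H
  coassoc := by
    ext1 f
    apply tripleEquiv.injective
    ext x y z
    simp only [LinearMap.comp_apply, LinearEquiv.coe_coe, TensorProduct.AlgebraTensorModule.curry_apply,
      LinearMap.restrictScalars_self, TensorProduct.curry_apply, tripleEquiv_rTensor,
      tripleEquiv_lTensor, pairEquiv_comulMap, LinearMap.mul'_apply, mul_assoc]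
  rTensor_counit_comp_comul := by
    ext1 f
    apply (TensorProduct.lid K _).injective
    ext x
    simp only [LinearMap.comp_apply]
    rw [rTensor_counitMap, pairEquiv_comulMap]
    simp
  lTensor_counit_comp_comul := by
    ext1 f
    apply (TensorProduct.rid K _).injective
    ext x
    simp only [LinearMap.comp_apply]
    rw [lTensor_counitMap, pairEquiv_comulMap]
    simp

lemma mul_eq (f g : HopfDual K H) (x : H) :
    (f * g) x = pairEquiv K H (f ⊗ₜ g) (Coalgebra.comul x) := by
  rw [mul_apply]
  induction (Coalgebra.comul (R := K) x) with
  | zero => simp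
  | add a b ha hb => simp only [map_add, ha, hb]
  | tmul a b => simp [pairEquiv_tmul]

lemma pairEquiv_mul (s t : HopfDual K H ⊗[K] HopfDual K H) (x y : H) :
    pairEquiv K H (s * t) (x ⊗ₜ y) =
      LinearMap.mul' K K (TensorProduct.map (pairEquiv K H s) (pairEquiv K H t)
        (TensorProduct.tensorTensorTensorComm K H H H H
          (Coalgebra.comul x ⊗ₜ Coalgebra.comul y))) := by
  induction s with
  | zero => simp
  | add a b ha hb =>
    simp only [add_mul, map_add, LinearMap.add_apply, ha, hb, TensorProduct.map_add_left]
  | tmul f g =>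
    induction t with
    | zero => simp
    | add a b ha hb =>
      simp only [mul_add, map_add, LinearMap.add_apply, ha, hb, TensorProduct.map_add_right]
    | tmul h k =>
      rw [Algebra.TensorProduct.tmul_mul_tmul, pairEquiv_tmul, mul_eq, mul_eq]
      generalize Coalgebra.comul (R := K) x = a
      generalize Coalgebra.comul (R := K) y = b
      induction a with
      | zero => simp
      | add a a' ha ha' =>
        simp only [TensorProduct.add_tmul, map_add, add_mul, ha, ha']
      | tmul a a' =>
        induction b with
        | zero => simp
        | add b b' hb hb' =>
          simp only [TensorProduct.tmul_add, map_add, mul_add, hb, hb']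
        | tmul b b' =>
          simp only [TensorProduct.tensorTensorTensorComm_tmul, TensorProduct.map_tmul,
            LinearMap.mul'_apply, pairEquiv_tmul]
          ring

lemma counitMap_mul (f g : HopfDual K H) :
    counitMap K H (f * g) = counitMap K H f * counitMap K H g := by
  rw [counitMap_apply, mul_eq, Bialgebra.comul_one, Algebra.TensorProduct.one_def, pairEquiv_tmul]
  rfl

lemma comulMap_one : comulMap K H 1 = 1 := by
  apply (pairEquiv K H).injective
  ext x y
  simp only [TensorProduct.AlgebraTensorModule.curry_apply, LinearMap.restrictScalars_self,
    TensorProduct.curry_apply, pairEquiv_comulMap, Algebra.TensorProduct.one_def, pairEquiv_tmul]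
  simp [one_apply]

lemma comulMap_mul (f g : HopfDual K H) :
    comulMap K H (f * g) = comulMap K H f * comulMap K H g := by
  apply (pairEquiv K H).injective
  ext x y
  simp only [TensorProduct.AlgebraTensorModule.curry_apply, LinearMap.restrictScalars_self,
    TensorProduct.curry_apply, pairEquiv_comulMap, pairEquiv_mul, LinearMap.mul'_apply, mul_eq,
    Bialgebra.comul_mul]
  generalize Coalgebra.comul (R := K) x = a
  generalize Coalgebra.comul (R := K) y = b
  induction a with
  | zero => simp
  | add a a' ha ha' => simp only [TensorProduct.add_tmul, map_add, add_mul, ha, ha']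
  | tmul a a' =>
    induction b with
    | zero => simp
    | add b b' hb hb' => simp only [TensorProduct.tmul_add, map_add, mul_add, hb, hb']
    | tmul b b' =>
      simp only [TensorProduct.tensorTensorTensorComm_tmul, TensorProduct.map_tmul,
        LinearMap.mul'_apply, pairEquiv_tmul, pairEquiv_comulMap,
        Algebra.TensorProduct.tmul_mul_tmul]

instance instBialgebra : Bialgebra K (HopfDual K H) :=
  Bialgebra.mk' K (HopfDual K H) (by change counitMap K H 1 = 1; simp [counitMap_apply, one_apply])
    (fun {f g} => counitMap_mul f g) comulMap_one (fun {f g} => comulMap_mul f g)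

lemma mul_rTensor_antipodeMap (s : HopfDual K H ⊗[K] HopfDual K H) (x : H) :
    (LinearMap.mul' K (HopfDual K H) ((antipodeMap K H).rTensor (HopfDual K H) s)) x =
      pairEquiv K H s ((HopfAlgebra.antipode K).rTensor H (Coalgebra.comul x)) := by
  induction s with
  | zero => simp
  | add a b ha hb =>
    simp only [map_add, LinearMap.add_apply, ha, hb]
  | tmul f g =>
    rw [LinearMap.rTensor_tmul, LinearMap.mul'_apply, mul_eq]
    induction (Coalgebra.comul (R := K) x) with
    | zero => simp
    | add a b ha hb => simp only [map_add, ha, hb]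
    | tmul a b => rfl

lemma mul_lTensor_antipodeMap (s : HopfDual K H ⊗[K] HopfDual K H) (x : H) :
    (LinearMap.mul' K (HopfDual K H) ((antipodeMap K H).lTensor (HopfDual K H) s)) x =
      pairEquiv K H s ((HopfAlgebra.antipode K).lTensor H (Coalgebra.comul x)) := by
  induction s with
  | zero => simp
  | add a b ha hb =>
    simp only [map_add, LinearMap.add_apply, ha, hb]
  | tmul f g =>
    rw [LinearMap.lTensor_tmul, LinearMap.mul'_apply, mul_eq]
    induction (Coalgebra.comul (R := K) x) with
    | zero => simp
    | add a b ha hb => simp only [map_add, ha, hb]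
    | tmul a b => rfl

/-- The dual Hopf algebra of a finite dimensional Hopf algebra: the multiplication, unit,
comultiplication, counit and antipode are the transposes of the comultiplication, counit,
multiplication, unit and antipode of `H`. -/
instance instHopfAlgebra : HopfAlgebra K (HopfDual K H) where
  antipode := antipodeMap K H
  mul_antipode_rTensor_comul := by
    ext f x
    simp only [LinearMap.comp_apply]
    rw [mul_rTensor_antipodeMap]
    change pairEquiv K H (comulMap K H f) _ = _
    rw [pairEquiv_comulMap, HopfAlgebra.mul_antipode_rTensor_comul_apply]
    change _ = (algebraMap K (HopfDual K H) (counitMap K H f)) x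
    rw [algebraMap_apply, counitMap_apply, mul_comm, Algebra.algebraMap_eq_smul_one]
    simp
  mul_antipode_lTensor_comul := by
    ext f x
    simp only [LinearMap.comp_apply]
    rw [mul_lTensor_antipodeMap]
    change pairEquiv K H (comulMap K H f) _ = _
    rw [pairEquiv_comulMap, HopfAlgebra.mul_antipode_lTensor_comul_apply]
    change _ = (algebraMap K (HopfDual K H) (counitMap K H f)) x
    rw [algebraMap_apply, counitMap_apply, mul_comm, Algebra.algebraMap_eq_smul_one]
    simp

end Laws

end HopfDual

section Integrals

/-- The character of the regular representation of a finite dimensional algebra `A`: the trace of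
left multiplication by `x` on `A`. -/
def regularCharacter (K : Type u) (A : Type v) [Field K] [Ring A] [Algebra K A] : A →ₗ[K] K :=
  LinearMap.trace K A ∘ₗ LinearMap.mul K A

variable (K : Type u) (H : Type v) [Field K] [Ring H] [HopfAlgebra K H]

/-- `λ ∈ H^*`: the character of the regular representation of `H`. -/
def lam : HopfDual K H := (HopfDual.toDual K H).symm (regularCharacter K H)

/-- `ℓ ∈ H`: the character of the regular representation of `H^*`, as an element of
`H = H^{**}`. It is the element such that `f(ℓ)` is the trace of left multiplication by `f` on
`H^*`, for all `f ∈ H^*`. -/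
def ell [FiniteDimensional K H] : H :=
  (Module.evalEquiv K H).symm
    (regularCharacter K (HopfDual K H) ∘ₗ (HopfDual.toDual K H).symm.toLinearMap)

/-- A left integral `x` of `H`, that is `y x = ε(y) x` for all `y`, normalized by
`ε(x) = dim H`. -/
def IsNormalizedIntegral (x : H) : Prop :=
  (∀ y : H, y * x = Coalgebra.counit (R := K) y • x) ∧
    Coalgebra.counit (R := K) x = (Module.finrank K H : K)

/-- The element `c_H^1 = ℓ¹₁ ℓ²₁ S(ℓ¹₂) S(ℓ²₂)` of `H`, where `ℓ¹` and `ℓ²` are two copies of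
`ℓ`. It is the image under the multiplication `H ⊗ H → H` of the square, in the algebra `H ⊗ H`,
of `ℓ₁ ⊗ S(ℓ₂)`. -/
def cOne [FiniteDimensional K H] : H :=
  LinearMap.mul' K H
    ((HopfAlgebra.antipode K (A := H)).lTensor H (Coalgebra.comul (R := K) (ell K H)) *
      (HopfAlgebra.antipode K (A := H)).lTensor H (Coalgebra.comul (R := K) (ell K H)))

/-- The formula `c_H^1 = ∑ i, (dim H / dim W_i)² e_i`: here `(W_i)` is any finite list of
irreducible representations of `H` containing each isomorphism class exactly once, and `e_i` is
the element of `H` acting as the identity on `W_i` and as `0` on the other `W_j`. -/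
def COneFormula [FiniteDimensional K H] : Prop :=
  ∀ (ι : Type) [Fintype ι] [DecidableEq ι] (W : ι → Type v) [∀ i, AddCommGroup (W i)]
    [∀ i, Module K (W i)] [∀ i, Module H (W i)] [∀ i, IsScalarTower K H (W i)] (e : ι → H),
    (∀ i, IsSimpleModule H (W i)) →
    (∀ i j, Nonempty (W i ≃ₗ[H] W j) → i = j) →
    (∀ (V : Type v) [AddCommGroup V] [Module H V], IsSimpleModule H V →
      ∃ i, Nonempty (V ≃ₗ[H] W i)) →
    (∀ i j (x : W j), e i • x = if i = j then x else 0) →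
    cOne K H =
      ∑ i, ((Module.finrank K H : K) / (Module.finrank K (W i) : K)) ^ 2 • e i

/-- The dimension of every irreducible representation of the algebra `A` divides `d`. -/
def IrrepDimsDvd (A : Type v) [Ring A] [Algebra K A] (d : ℕ) : Prop :=
  ∀ (W : Type w) [AddCommGroup W] [Module K W] [Module A W] [IsScalarTower K A W],
    IsSimpleModule A W → Module.finrank K W ∣ d

end Integrals

section BasicInvariants

variable {K : Type u} {C : Type v} [Field K] [Ring C] [HopfAlgebra K C]

variable (K C) in
/-- The identification `C^{⊗ n} ⊗ C ≃ C^{⊗ (n + 1)}`. -/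
def snocEquiv (n : ℕ) : (⨂[K]^n C) ⊗[K] C ≃ₗ[K] ⨂[K]^(n + 1) C :=
  (TensorProduct.congr (LinearEquiv.refl K (⨂[K]^n C))
    (PiTensorProduct.subsingletonEquiv (R := K) (s := fun _ : Fin 1 => C) 0).symm).trans
    TensorPower.mulEquiv

variable (K C) in
/-- Comultiplication applied to the last tensor factor,
`x₁ ⊗ ⋯ ⊗ xₙ ⊗ x ↦ x₁ ⊗ ⋯ ⊗ xₙ ⊗ Δ(x)`, as a map `C^{⊗ (n + 1)} → C^{⊗ (n + 2)}`. -/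
def comulLast (n : ℕ) : (⨂[K]^(n + 1) C) →ₗ[K] ⨂[K]^(n + 2) C :=
  (snocEquiv K C (n + 1)).toLinearMap ∘ₗ
    (snocEquiv K C n).toLinearMap.rTensor C ∘ₗ
      (TensorProduct.assoc K (⨂[K]^n C) C C).symm.toLinearMap ∘ₗ
        (Coalgebra.comul (R := K) (A := C)).lTensor (⨂[K]^n C) ∘ₗ
          (snocEquiv K C n).symm.toLinearMap

/-- `IsCoproductTensor x n t`: the tensor `t ∈ C^{⊗ n}` arises from some power `x^{⊗ a}` by
repeatedly applying the comultiplication to tensor factors and permuting the tensor factors.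
(By means of permutations it suffices to comultiply the last factor.) -/
inductive IsCoproductTensor (x : C) : (n : ℕ) → (⨂[K]^n C) → Prop
  | base (a : ℕ) : IsCoproductTensor x a (PiTensorProduct.tprod K fun _ : Fin a => x)
  | comul {n : ℕ} {t : ⨂[K]^(n + 1) C} (h : IsCoproductTensor x (n + 1) t) :
      IsCoproductTensor x (n + 2) (comulLast K C n t)
  | perm {n : ℕ} {t : ⨂[K]^n C} (σ : Equiv.Perm (Fin n)) (h : IsCoproductTensor x n t) :
      IsCoproductTensor x n (PiTensorProduct.reindex K (fun _ => C) σ t)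

variable (K C) in
/-- The evaluation pairing of `(C^*)^{⊗ n}` with `C^{⊗ n}`, factor by factor. -/
def tensorPairing (n : ℕ) : (⨂[K]^n (HopfDual K C)) →ₗ[K] Module.Dual K (⨂[K]^n C) :=
  PiTensorProduct.dualDistrib ∘ₗ
    PiTensorProduct.map fun _ : Fin n => (HopfDual.toDual K C).toLinearMap

variable (K C) in
/-- A basic invariant of `C`: a scalar obtained from `ℓ^{⊗ a} ⊗ λ^{⊗ b}` by repeatedly
comultiplying tensor factors in `C` and in `C^*` and permuting them, until a tensor in
`C^{⊗ n} ⊗ (C^*)^{⊗ n}` is reached, and then pairing the factors in `C` with those in `C^*`. -/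
def IsBasicInvariant [FiniteDimensional K C] (a : K) : Prop :=
  ∃ (n : ℕ) (t : ⨂[K]^n C) (s : ⨂[K]^n (HopfDual K C)),
    IsCoproductTensor (K := K) (ell K C) n t ∧
      IsCoproductTensor (K := K) (lam K C) n s ∧ a = tensorPairing K C n s t

end BasicInvariants

end

/-!
# Regular characters, the Casimir element and Kaplansky's sixth conjecture

Everything rests on the theorem of Larson and Radford (`larson_radford`): `H^*` is again semisimple,
and the antipode `S` is an involution. It is proved from integrals. A semisimple Hopf algebra has a
two-sided integral `t` with `ε(t) = 1`, and the form `μ(x) = Tr (y ↦ x S²(y))` is a left integral of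
`H^*` with `μ(t) = 1` (`mul_traceForm_antipode`). The pair `(t, μ)` is a Frobenius structure: `S²`
is its Nakayama automorphism, so it fixes the centre, and `S⁴` is the conjugation by a group-like
element, so it has finite order. Hence `S²` acts on each matrix block of `H` as an inner
automorphism of finite order, whose trace has the form `|∑ c|²` for roots of unity `c`; the block of
the trivial representation contributes `1`, so that `Tr S² ≠ 0` (`trace_ne_zero_of_central`). As
`μ(1) = Tr S²`, Maschke's theorem gives the semisimplicity of `H^*`; then `μ` is a two-sided
integral, the group-like element is `1`, and `S⁴ = 1`. Finally `n = dim H` divides the integer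
`Tr S²`, because `n⁻¹ ℓ` is an idempotent fixed by `S²` and `Tr S²` is `n` times the trace of `S²`
composed with the corresponding projection; a nonzero trace of an involution of an `n`-dimensional
space which is a multiple of `n` forces `S² = ± 1` (`eq_one_of_trace_eq`).

Once `S² = 1`, the form `μ` is the regular character `λ`, so that `λ` is a left integral, and dually
so is `ℓ`; integrals are unique up to scalars. On a simple module `W`, Schur's lemma shows that
`B ↦ ρ(ℓ₁) B ρ(S(ℓ₂))` is `(dim H / dim W) Tr(B)` times the identity (`casimirMap_ell`), and
therefore that `X ↦ Tr(ρ(ℓ₁) X) ρ(S(ℓ₂))` is multiplication by `dim H / dim W`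
(`casimirTrace_ell`). Consequently the word `ℓ¹₁ ⋯ ℓᵐ₁ S(ℓ¹₂) ⋯ S(ℓᵐ₂)` with `m = 2 k` acts on `W`
by `(dim H / dim W)^{2k}` (`casimirWord_two_mul_smul`). The case `k = 1` is the formula for `c_H^1`.

For the divisibility, `λ(c^k) = ∑ wᵢ qᵢᵏ` with positive integers `wᵢ` and `qᵢ = (dim H / dim Wᵢ)²`
rational. If these sums are integral up to a common factor for all `k`, then each `qᵢ` is an integer
(`isIntegral_of_forall_sum_mul_pow`), and so is its square root.

Basic invariants involve no antipode. But since `ℓ₁ λ(ℓ₂ x) = n S(x)`, pairing `2 k + 1` copies of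
`Δ(ℓ)` with two iterated coproducts of `λ`, the second in reversed order, gives `n` times the value
of `λ` at the word with `m = 2 k` (`sum_lam_mul_lam`), and the criterion above applies. Basic
invariants of `H^*` are basic invariants of `H` through the identification `H = H^{**}`, which gives
the statement for `H^*`.
-/

namespace FinHopf

open Coalgebra HopfAlgebra

/-! ### Integrals and the comultiplication -/

section Sweedler

variable {K : Type u} {H : Type v} [Field K] [Ring H] [HopfAlgebra K H]

lemma sum_counit_smul_left (x : H) :
    ∑ i ∈ (ℛ K x).index, counit (R := K) ((ℛ K x).right i) • (ℛ K x).left i = x := by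
  have := congrArg (TensorProduct.rid K H) (sum_tmul_counit_eq (R := K) (ℛ K x))
  rw [map_sum] at this
  simpa only [TensorProduct.rid_tmul, one_smul] using this

/-- `S(x₁) x₂ ⊗ x₃ = 1 ⊗ x`. -/
lemma sum_antipode_tmul_one_mul_comul (x : H) :
    ∑ i ∈ (ℛ K x).index, (antipode K ((ℛ K x).left i) ⊗ₜ[K] (1 : H)) *
      comul (R := K) ((ℛ K x).right i) = 1 ⊗ₜ x := by
  have h := congrArg ((LinearMap.mul' K H ∘ₗ (antipode K (A := H)).rTensor H).rTensor H ∘ₗ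
    (TensorProduct.assoc K H H H).symm.toLinearMap)
    (sum_tmul_tmul_eq (ℛ K x) (fun i => ℛ K ((ℛ K x).left i)) (fun i => ℛ K ((ℛ K x).right i)))
  simp only [map_sum, LinearMap.comp_apply, LinearEquiv.coe_coe, TensorProduct.assoc_symm_tmul,
    LinearMap.rTensor_tmul, LinearMap.mul'_apply] at h
  calc _ = _ := by
        refine Finset.sum_congr rfl fun i _ => ?_
        conv_lhs => rw [← (ℛ K ((ℛ K x).right i)).eq]
        rw [Finset.mul_sum]
        simp only [Algebra.TensorProduct.tmul_mul_tmul, one_mul]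
    _ = _ := h.symm
    _ = _ := by
        simp only [← TensorProduct.sum_tmul, sum_antipode_mul_eq_smul, TensorProduct.smul_tmul]
        rw [← TensorProduct.tmul_sum, sum_counit_smul]

/-- `x₁ ⊗ x₂ S(x₃) = x ⊗ 1`. -/
lemma sum_comul_mul_one_tmul_antipode (x : H) :
    ∑ i ∈ (ℛ K x).index, comul (R := K) ((ℛ K x).left i) *
      ((1 : H) ⊗ₜ[K] antipode K ((ℛ K x).right i)) = x ⊗ₜ 1 := by
  have h := congrArg ((LinearMap.mul' K H ∘ₗ (antipode K (A := H)).lTensor H).lTensor H)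
    (sum_tmul_tmul_eq (ℛ K x) (fun i => ℛ K ((ℛ K x).left i)) (fun i => ℛ K ((ℛ K x).right i)))
  simp only [map_sum, LinearMap.comp_apply, LinearMap.lTensor_tmul, LinearMap.mul'_apply] at h
  calc _ = _ := by
        refine Finset.sum_congr rfl fun i _ => ?_
        conv_lhs => rw [← (ℛ K ((ℛ K x).left i)).eq]
        rw [Finset.sum_mul]
        simp only [Algebra.TensorProduct.tmul_mul_tmul, mul_one]
    _ = _ := h
    _ = _ := by
        simp only [← TensorProduct.tmul_sum, sum_mul_antipode_eq_smul, TensorProduct.tmul_smul,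
          TensorProduct.smul_tmul']
        rw [← TensorProduct.sum_tmul]
        rw [sum_counit_smul_left]

/-- Left integrals satisfy `t₁ ⊗ x t₂ = S(x) t₁ ⊗ t₂`. -/
lemma one_tmul_mul_comul {t : H} (ht : ∀ y : H, y * t = counit (R := K) y • t) (x : H) :
    ((1 : H) ⊗ₜ[K] x) * comul (R := K) t = (antipode K x ⊗ₜ[K] (1 : H)) * comul (R := K) t := by
  rw [← sum_antipode_tmul_one_mul_comul, Finset.sum_mul]
  conv_rhs => rw [← sum_counit_smul_left (K := K) x]
  simp only [mul_assoc, ← Bialgebra.comul_mul, ht, map_smul, map_sum, TensorProduct.sum_tmul,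
    Finset.sum_mul, mul_smul_comm, ← TensorProduct.smul_tmul', smul_mul_assoc]

/-- Right integrals satisfy `t₁ x ⊗ t₂ = t₁ ⊗ t₂ S(x)`. -/
lemma comul_mul_tmul_one {t : H} (ht : ∀ y : H, t * y = counit (R := K) y • t) (x : H) :
    comul (R := K) t * (x ⊗ₜ[K] (1 : H)) = comul (R := K) t * ((1 : H) ⊗ₜ[K] antipode K x) := by
  rw [← sum_comul_mul_one_tmul_antipode, Finset.mul_sum]
  conv_rhs => rw [← sum_counit_smul (ℛ K x)]
  simp only [← mul_assoc, ← Bialgebra.comul_mul, ht, map_smul, map_sum, TensorProduct.tmul_sum,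
    Finset.mul_sum, mul_smul_comm, TensorProduct.tmul_smul, smul_mul_assoc]

end Sweedler

/-! ### Contractions of the tensor square -/

section Contraction

variable {K : Type u} {H : Type v} [Field K] [Ring H] [HopfAlgebra K H]

lemma eq_of_dual {x y : H} (h : ∀ f : HopfDual K H, f x = f y) : x = y := by
  rw [← sub_eq_zero, ← Module.forall_dual_apply_eq_zero_iff K]
  intro f
  rw [map_sub, sub_eq_zero]
  exact h ((HopfDual.toDual K H).symm f)

/-- The contraction `a ⊗ b ↦ f(b) a`. -/
noncomputable def contractRight (f : H →ₗ[K] K) : H ⊗[K] H →ₗ[K] H :=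
  (TensorProduct.rid K H).toLinearMap ∘ₗ f.lTensor H

/-- The contraction `a ⊗ b ↦ f(a) b`. -/
noncomputable def contractLeft (f : H →ₗ[K] K) : H ⊗[K] H →ₗ[K] H :=
  (TensorProduct.lid K H).toLinearMap ∘ₗ f.rTensor H

@[simp] lemma contractRight_tmul (f : H →ₗ[K] K) (a b : H) :
    contractRight f (a ⊗ₜ b) = f b • a := by simp [contractRight]

@[simp] lemma contractLeft_tmul (f : H →ₗ[K] K) (a b : H) :
    contractLeft f (a ⊗ₜ b) = f a • b := by simp [contractLeft]

lemma contractRight_tmul_one_mul (f : H →ₗ[K] K) (x : H) (t : H ⊗[K] H) :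
    contractRight f ((x ⊗ₜ 1) * t) = x * contractRight f t := by
  induction t with
  | zero => simp
  | add a b ha hb => simp only [mul_add, map_add, ha, hb]
  | tmul a b => simp

lemma contractRight_mul_tmul_one (f : H →ₗ[K] K) (x : H) (t : H ⊗[K] H) :
    contractRight f (t * (x ⊗ₜ 1)) = contractRight f t * x := by
  induction t with
  | zero => simp
  | add a b ha hb => simp only [add_mul, map_add, ha, hb]
  | tmul a b => simp

lemma contractRight_one_tmul_mul (f : H →ₗ[K] K) (x : H) (t : H ⊗[K] H) :
    contractRight f ((1 ⊗ₜ x) * t) = contractRight (f ∘ₗ LinearMap.mulLeft K x) t := by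
  induction t with
  | zero => simp
  | add a b ha hb => simp only [mul_add, map_add, ha, hb]
  | tmul a b => simp

lemma contractRight_mul_one_tmul (f : H →ₗ[K] K) (x : H) (t : H ⊗[K] H) :
    contractRight f (t * (1 ⊗ₜ x)) = contractRight (f ∘ₗ LinearMap.mulRight K x) t := by
  induction t with
  | zero => simp
  | add a b ha hb => simp only [add_mul, map_add, ha, hb]
  | tmul a b => simp

lemma contractLeft_tmul_one_mul (f : H →ₗ[K] K) (x : H) (t : H ⊗[K] H) :
    contractLeft f ((x ⊗ₜ 1) * t) = contractLeft (f ∘ₗ LinearMap.mulLeft K x) t := by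
  induction t with
  | zero => simp
  | add a b ha hb => simp only [mul_add, map_add, ha, hb]
  | tmul a b => simp

lemma contractLeft_mul_tmul_one (f : H →ₗ[K] K) (x : H) (t : H ⊗[K] H) :
    contractLeft f (t * (x ⊗ₜ 1)) = contractLeft (f ∘ₗ LinearMap.mulRight K x) t := by
  induction t with
  | zero => simp
  | add a b ha hb => simp only [add_mul, map_add, ha, hb]
  | tmul a b => simp

lemma contractLeft_one_tmul_mul (f : H →ₗ[K] K) (x : H) (t : H ⊗[K] H) :
    contractLeft f ((1 ⊗ₜ x) * t) = x * contractLeft f t := by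
  induction t with
  | zero => simp
  | add a b ha hb => simp only [mul_add, map_add, ha, hb]
  | tmul a b => simp

lemma contractLeft_mul_one_tmul (f : H →ₗ[K] K) (x : H) (t : H ⊗[K] H) :
    contractLeft f (t * (1 ⊗ₜ x)) = contractLeft f t * x := by
  induction t with
  | zero => simp
  | add a b ha hb => simp only [add_mul, map_add, ha, hb]
  | tmul a b => simp

lemma mul_apply_eq_contractRight (f g : HopfDual K H) (x : H) :
    (f * g) x = f (contractRight (HopfDual.toDual K H g) (comul x)) := by
  rw [HopfDual.mul_apply]
  induction (comul (R := K) x) with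
  | zero => simp
  | add a b ha hb => simp only [map_add, ha, hb]
  | tmul a b => simp [mul_comm]

lemma mul_apply_eq_contractLeft (f g : HopfDual K H) (x : H) :
    (f * g) x = g (contractLeft (HopfDual.toDual K H f) (comul x)) := by
  rw [HopfDual.mul_apply]
  induction (comul (R := K) x) with
  | zero => simp
  | add a b ha hb => simp only [map_add, ha, hb]
  | tmul a b => simp

end Contraction

/-! ### Integrals and the antipode -/

section Integrals

variable {K : Type u} {H : Type v} [Field K] [Ring H] [HopfAlgebra K H]

/-- `t` is a two-sided integral of `H`. -/
structure IsIntegralElem (K : Type u) {H : Type v} [Field K] [Ring H] [HopfAlgebra K H]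
    (t : H) : Prop where
  left : ∀ y : H, y * t = counit (R := K) y • t
  right : ∀ y : H, t * y = counit (R := K) y • t

/-- `x₁ μ(x₂) = μ(x) 1` for a left integral `μ` of `H^*`. -/
lemma contractRight_comul_of_integral {μ : HopfDual K H}
    (hμ : ∀ f : HopfDual K H, f * μ = f 1 • μ) (x : H) :
    contractRight (HopfDual.toDual K H μ) (comul x) = μ x • 1 := by
  refine eq_of_dual (K := K) fun f => ?_
  rw [← mul_apply_eq_contractRight, hμ, map_smul, map_smul, LinearMap.smul_apply, smul_eq_mul,
    smul_eq_mul, mul_comm]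

variable {t : H} {μ : HopfDual K H}

/-- `t₁ μ(x t₂) = S(x)`: move `x` to the left factor of `Δ(t)`, then use that `μ` is an integral. -/
lemma contractRight_mulLeft (ht : IsIntegralElem K t) (hμ : ∀ f : HopfDual K H, f * μ = f 1 • μ)
    (hμt : μ t = 1) (x : H) :
    contractRight (HopfDual.toDual K H μ ∘ₗ LinearMap.mulLeft K x) (comul t) = antipode K x := by
  rw [← contractRight_one_tmul_mul, one_tmul_mul_comul ht.left, contractRight_tmul_one_mul,
    contractRight_comul_of_integral hμ, hμt, one_smul, mul_one]

/-- `t₁ μ(t₂ S(x)) = x` -/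
lemma contractRight_mulRight (ht : IsIntegralElem K t) (hμ : ∀ f : HopfDual K H, f * μ = f 1 • μ)
    (hμt : μ t = 1) (x : H) :
    contractRight (HopfDual.toDual K H μ ∘ₗ LinearMap.mulRight K (antipode K x)) (comul t) = x := by
  rw [← contractRight_mul_one_tmul, ← comul_mul_tmul_one ht.right, contractRight_mul_tmul_one,
    contractRight_comul_of_integral hμ, hμt, one_smul, one_mul]

lemma antipode_injective (ht : IsIntegralElem K t) (hμ : ∀ f : HopfDual K H, f * μ = f 1 • μ)
    (hμt : μ t = 1) : Function.Injective (antipode K : H →ₗ[K] H) := fun x y h => by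
  rw [← contractRight_mulRight ht hμ hμt x, h, contractRight_mulRight ht hμ hμt y]

variable [FiniteDimensional K H]

lemma antipode_bijective (ht : IsIntegralElem K t) (hμ : ∀ f : HopfDual K H, f * μ = f 1 • μ)
    (hμt : μ t = 1) : Function.Bijective (antipode K : H →ₗ[K] H) :=
  ⟨antipode_injective ht hμ hμt,
    LinearMap.surjective_of_injective (antipode_injective ht hμ hμt)⟩

/-- `μ` is a Frobenius form with dual bases given by `Δ(t)`: the map `f ↦ t₁ f(t₂)` is surjective by
`contractRight_mulRight`, so it is injective for reasons of dimension. -/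
lemma contractRight_comul_injective (ht : IsIntegralElem K t)
    (hμ : ∀ f : HopfDual K H, f * μ = f 1 • μ) (hμt : μ t = 1) {f g : H →ₗ[K] K}
    (h : contractRight f (comul t) = contractRight g (comul t)) : f = g := by
  let Ψ : (H →ₗ[K] K) →ₗ[K] H :=
    { toFun := fun f => contractRight f (comul t)
      map_add' := fun f g => by
        generalize comul (R := K) t = s
        induction s with
        | zero => simp
        | add a b ha hb => simp only [map_add, ha, hb]; abel
        | tmul a b => simp [add_smul]
      map_smul' := fun c f => by
        generalize comul (R := K) t = s
        induction s with
        | zero => simp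
        | add a b ha hb => simp only [map_add, ha, hb, smul_add]
        | tmul a b => simp [mul_smul] }
  have hs : Function.Surjective Ψ := fun x => ⟨_, contractRight_mulRight ht hμ hμt x⟩
  have hi : Function.Injective Ψ :=
    (LinearMap.injective_iff_surjective_of_finrank_eq_finrank
      (Subspace.dual_finrank_eq (K := K) (V := H))).2 hs
  exact hi h

/-- The Nakayama automorphism of the Frobenius form `μ` is the square of the antipode. -/
lemma integral_mul_comm (ht : IsIntegralElem K t) (hμ : ∀ f : HopfDual K H, f * μ = f 1 • μ)
    (hμt : μ t = 1) (x : H) :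
    HopfDual.toDual K H μ ∘ₗ LinearMap.mulLeft K x =
      HopfDual.toDual K H μ ∘ₗ LinearMap.mulRight K (antipode K (antipode K x)) := by
  apply contractRight_comul_injective ht hμ hμt
  rw [contractRight_mulLeft ht hμ hμt, contractRight_mulRight ht hμ hμt]

/-- The square of the antipode fixes the centre: for `y = S⁻¹(z)` central, both `y` and `S(y)` move
freely through `Δ(t)`, so that `t₁ ⊗ t₂ y = t₁ ⊗ t₂ S(S(y))`. -/
lemma antipode_antipode_of_central (ht : IsIntegralElem K t)
    (hμ : ∀ f : HopfDual K H, f * μ = f 1 • μ) (hμt : μ t = 1) {z : H} (hz : ∀ x, z * x = x * z) :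
    antipode K (antipode K z) = z := by
  obtain ⟨y, rfl⟩ := (antipode_bijective ht hμ hμt).2 z
  have hy : ∀ x, y * x = x * y := fun x => antipode_injective ht hμ hμt <| by
    rw [antipode_mul_antidistrib, antipode_mul_antidistrib, hz]
  suffices y = antipode K (antipode K y) by rw [← this]
  have h1 : ∀ s : H ⊗[K] H,
      (antipode K y ⊗ₜ[K] (1 : H)) * s = s * (antipode K y ⊗ₜ[K] (1 : H)) := by
    intro s
    induction s with
    | zero => simp
    | add a b ha hb => simp only [mul_add, add_mul, ha, hb]
    | tmul a b => simp [hz]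
  have h2 := one_tmul_mul_comul (K := K) ht.left y
  rw [h1, comul_mul_tmul_one ht.right] at h2
  have h3 : ∀ s : H ⊗[K] H, ((1 : H) ⊗ₜ[K] y) * s = s * ((1 : H) ⊗ₜ[K] y) := by
    intro s
    induction s with
    | zero => simp
    | add a b ha hb => simp only [mul_add, add_mul, ha, hb]
    | tmul a b => simp [hy]
  rw [h3] at h2
  obtain ⟨w, hw⟩ := (antipode_bijective ht hμ hμt).2 y
  have h4 := congrArg (contractRight (HopfDual.toDual K H μ)) h2
  rw [contractRight_mul_one_tmul, contractRight_mul_one_tmul, contractRight_mulRight ht hμ hμt,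
    ← hw, contractRight_mulRight ht hμ hμt, hw] at h4
  rw [← h4, hw]

/-- The distinguished element `g = μ(t₁) t₂` satisfies `x g = g S⁴(x)`. -/
lemma mul_distinguished (ht : IsIntegralElem K t)
    (hμ : ∀ f : HopfDual K H, f * μ = f 1 • μ) (hμt : μ t = 1) (x : H) :
    x * contractLeft (HopfDual.toDual K H μ) (comul t) =
      contractLeft (HopfDual.toDual K H μ) (comul t) *
        antipode K (antipode K (antipode K (antipode K x))) := by
  rw [← contractLeft_one_tmul_mul, one_tmul_mul_comul ht.left, contractLeft_tmul_one_mul,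
    integral_mul_comm ht hμ hμt, ← contractLeft_mul_tmul_one, comul_mul_tmul_one ht.right,
    contractLeft_mul_one_tmul]

/-- Left integrals of `H^*` are unique up to scalars. -/
lemma eq_smul_of_integral (ht : IsIntegralElem K t)
    (hμ : ∀ f : HopfDual K H, f * μ = f 1 • μ) (hμt : μ t = 1) {ν : HopfDual K H}
    (hν : ∀ f : HopfDual K H, f * ν = f 1 • ν) : ν = ν t • μ := by
  apply (HopfDual.toDual K H).injective
  apply contractRight_comul_injective ht hμ hμt
  have h : ∀ f : HopfDual K H, f * (ν t • μ) = f 1 • (ν t • μ) := fun f => by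
    rw [mul_smul_comm, hμ, smul_comm]
  rw [contractRight_comul_of_integral hν, contractRight_comul_of_integral h, map_smul,
    LinearMap.smul_apply, hμt, smul_eq_mul, mul_one]

/-- The distinguished element is the modular function of the left integral `μ`. -/
lemma integral_mul (ht : IsIntegralElem K t)
    (hμ : ∀ f : HopfDual K H, f * μ = f 1 • μ) (hμt : μ t = 1) (f : HopfDual K H) :
    μ * f = f (contractLeft (HopfDual.toDual K H μ) (comul t)) • μ := by
  rw [← mul_apply_eq_contractLeft]
  exact eq_smul_of_integral ht hμ hμt fun f' => by rw [← mul_assoc, hμ, smul_mul_assoc]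

/-- The distinguished element is group-like: as the modular function of `μ`, it is a character of
`H^*`. -/
lemma isGroupLikeElem_distinguished (ht : IsIntegralElem K t)
    (hμ : ∀ f : HopfDual K H, f * μ = f 1 • μ) (hμt : μ t = 1) :
    IsGroupLikeElem K (contractLeft (HopfDual.toDual K H μ) (comul t)) := by
  set g := contractLeft (HopfDual.toDual K H μ) (comul t)
  have hμ0 : ∀ {c d : K}, c • μ = d • μ → c = d := fun {c d} h => by
    have := congrArg (fun f : HopfDual K H => f t) h
    simpa [hμt] using this
  have hm : ∀ f f' : HopfDual K H, (f * f') g = f g * f' g := fun f f' => hμ0 <| by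
    rw [← integral_mul ht hμ hμt, ← mul_assoc, integral_mul ht hμ hμt, smul_mul_assoc,
      integral_mul ht hμ hμt, smul_smul]
  refine ⟨?_, ?_⟩
  · apply hμ0
    have := integral_mul ht hμ hμt 1
    rw [mul_one] at this
    rw [one_smul]
    exact this.symm
  · rw [← sub_eq_zero, ← Module.forall_dual_apply_eq_zero_iff K]
    intro φ
    obtain ⟨s, rfl⟩ := (HopfDual.pairEquiv K H).surjective φ
    rw [map_sub, sub_eq_zero]
    induction s with
    | zero => simp
    | add a b ha hb => simp only [map_add, LinearMap.add_apply, ha, hb]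
    | tmul a b => rw [← HopfDual.mul_eq, hm, HopfDual.pairEquiv_tmul]

/-- The antipode has finite order: its fourth power is the conjugation by a group-like element, and
there are only finitely many of these, since they are linearly independent. -/
lemma exists_antipode_iterate_eq_id (ht : IsIntegralElem K t)
    (hμ : ∀ f : HopfDual K H, f * μ = f 1 • μ) (hμt : μ t = 1) :
    ∃ m : ℕ, 0 < m ∧ ∀ x : H, (antipode K : H →ₗ[K] H)^[4 * m] x = x := by
  set g := contractLeft (HopfDual.toDual K H μ) (comul t) with hg
  have hgl : IsGroupLikeElem K g := isGroupLikeElem_distinguished ht hμ hμt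
  have hfin : Finite (GroupLike K H) := (linearIndep_groupLikeVal (R := K) (A := H)).finite
  obtain ⟨m, hm, hgm⟩ := isOfFinOrder_iff_pow_eq_one.1
    (isOfFinOrder_of_finite (⟨g, hgl⟩ : GroupLike K H))
  have hgm' : g ^ m = 1 := congrArg GroupLike.val hgm
  refine ⟨m, hm, fun x => ?_⟩
  have key : ∀ (n : ℕ) (x : H), x * g ^ n = g ^ n * (antipode K : H →ₗ[K] H)^[4 * n] x := by
    intro n
    induction n with
    | zero => simp
    | succ n ih =>
      intro x
      rw [pow_succ, ← mul_assoc, ih, mul_assoc, mul_distinguished ht hμ hμt, ← hg, ← mul_assoc,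
        ← pow_succ, Nat.mul_succ, Nat.add_comm (4 * n), Function.iterate_add_apply]
      rfl
  have := key m x
  rw [hgm', mul_one, one_mul] at this
  exact this.symm

end Integrals

/-! ### Existence of integrals -/

section ExistsIntegral

/-- A complement of the augmentation ideal in the regular module is spanned by a left integral. -/
lemma exists_left_integral {K : Type u} {A : Type v} [Field K] [Ring A] [Algebra K A]
    [IsSemisimpleRing A] (ε : A →ₐ[K] K) : ∃ t : A, (∀ y, y * t = ε y • t) ∧ ε t = 1 := by
  obtain ⟨N, hN⟩ := exists_isCompl (RingHom.ker ε : Ideal A)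
  obtain ⟨a, ha, t, ht, hat⟩ :=
    Submodule.mem_sup.1 (hN.sup_eq_top ▸ Submodule.mem_top (x := (1 : A)))
  have hεa : ε a = 0 := ha
  have hεt : ε t = 1 := by
    have := congrArg ε hat
    rwa [map_add, hεa, zero_add, map_one] at this
  refine ⟨t, fun y => ?_, hεt⟩
  rw [← sub_eq_zero]
  refine (Submodule.disjoint_def.1 hN.disjoint) _ ?_ ?_
  · change ε _ = 0
    rw [map_sub, map_mul, map_smul, hεt, smul_eq_mul, sub_self]
  · refine N.sub_mem (N.smul_mem y ht) ?_
    rw [Algebra.smul_def]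
    exact N.smul_mem _ ht

variable {K : Type u} {H : Type v} [Field K] [Ring H] [HopfAlgebra K H]

/-- A semisimple Hopf algebra is unimodular: it has a two-sided integral with counit `1`. -/
lemma exists_integral [IsSemisimpleRing H] :
    ∃ t : H, IsIntegralElem K t ∧ counit (R := K) t = 1 := by
  obtain ⟨t, ht, ht1⟩ := exists_left_integral (Bialgebra.counitAlgHom K H)
  obtain ⟨s, hs, hs1⟩ := exists_left_integral
    (AlgHom.fromOpposite (Bialgebra.counitAlgHom K H) fun _ _ => mul_comm _ _)
  obtain ⟨s, rfl⟩ := MulOpposite.op_surjective s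
  have hs' : ∀ y, s * y = counit (R := K) y • s := fun y => MulOpposite.op_injective (hs (.op y))
  have hs1' : counit (R := K) s = 1 := hs1
  have ht' : ∀ y, y * t = counit (R := K) y • t := ht
  have ht1' : counit (R := K) t = 1 := ht1
  have hst : s = t := by
    have h1 := hs' t
    have h2 := ht' s
    rw [ht1', one_smul] at h1
    rw [hs1', one_smul] at h2
    exact h1.symm.trans h2
  exact ⟨t, ⟨ht', hst ▸ hs'⟩, ht1'⟩

/-- In a unimodular Hopf algebra a left integral is determined by its counit. -/
lemma IsIntegralElem.eq_smul {t : H} (ht : IsIntegralElem K t) (ht1 : counit (R := K) t = 1)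
    {x : H} (hx : ∀ y : H, y * x = counit (R := K) y • x) : x = counit (R := K) x • t := by
  rw [← ht.right, hx, ht1, one_smul]

end ExistsIntegral

/-! ### Trace forms and the coaction -/

section TraceForm

variable {K : Type u} {H : Type v} [Field K] [Ring H] [HopfAlgebra K H]

/-- The linear form `x ↦ Tr (y ↦ x φ(y))` on `H`. -/
noncomputable def traceForm (φ : H →ₗ[K] H) : HopfDual K H :=
  (HopfDual.toDual K H).symm
    (LinearMap.trace K H ∘ₗ LinearMap.mulRight K (φ : Module.End K H) ∘ₗ LinearMap.mul K H)

lemma traceForm_apply (φ : H →ₗ[K] H) (x : H) :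
    traceForm φ x = LinearMap.trace K H (LinearMap.mulLeft K x ∘ₗ φ) := rfl

/-- The operator `x ↦ f(x₁) x₂`. -/
noncomputable def hit (f : HopfDual K H) : H →ₗ[K] H :=
  contractLeft (HopfDual.toDual K H f) ∘ₗ comul

lemma hit_comp_hit (f g : HopfDual K H) : hit g ∘ₗ hit f = hit (f * g) := by
  ext x
  refine eq_of_dual (K := K) fun k => ?_
  simp only [hit, LinearMap.comp_apply]
  rw [← mul_apply_eq_contractLeft, ← mul_apply_eq_contractLeft, ← mul_apply_eq_contractLeft,
    mul_assoc]

lemma hit_one : hit (1 : HopfDual K H) = LinearMap.id := by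
  ext x
  refine eq_of_dual (K := K) fun k => ?_
  simp only [hit, LinearMap.comp_apply]
  rw [← mul_apply_eq_contractLeft, one_mul]; rfl

lemma contractLeft_sum {ι : Type*} (s : Finset ι) (f : ι → H →ₗ[K] K) (t : H ⊗[K] H) :
    contractLeft (∑ i ∈ s, f i) t = ∑ i ∈ s, contractLeft (f i) t := by
  induction t with
  | zero => simp
  | add a b ha hb => simp only [map_add, ha, hb, Finset.sum_add_distrib]
  | tmul a b => simp [Finset.sum_smul]

lemma contractLeft_smul (c : K) (f : H →ₗ[K] K) (t : H ⊗[K] H) :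
    contractLeft (c • f) t = c • contractLeft f t := by
  induction t with
  | zero => simp
  | add a b ha hb => simp only [map_add, ha, hb, smul_add]
  | tmul a b => simp [mul_smul]

lemma hit_sum {ι : Type*} (s : Finset ι) (f : ι → HopfDual K H) :
    hit (∑ i ∈ s, f i) = ∑ i ∈ s, hit (f i) := by
  ext x
  simp only [hit, map_sum, LinearMap.comp_apply, contractLeft_sum, LinearMap.sum_apply]

lemma hit_smul (c : K) (f : HopfDual K H) : hit (c • f) = c • hit f := by
  ext x
  simp only [hit, map_smul, LinearMap.comp_apply, contractLeft_smul, LinearMap.smul_apply]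

/-- `Δ(φ(x₂)) (ψ(x₁) ⊗ 1) = 1 ⊗ φ(x)` for a coalgebra map `φ` with `φ(x₂) ψ(x₁) = ε(x)`. -/
lemma sum_comul_mul_tmul_one {φ ψ : H →ₗ[K] H}
    (hφ : ∀ x, comul (R := K) (φ x) = TensorProduct.map φ φ (comul x))
    (hψ : ∀ x, LinearMap.mul' K H
      (TensorProduct.map φ ψ (TensorProduct.comm K H H (comul x))) = counit (R := K) x • 1)
    (x : H) :
    ∑ i ∈ (ℛ K x).index, comul (R := K) (φ ((ℛ K x).right i)) *
      (ψ ((ℛ K x).left i) ⊗ₜ[K] (1 : H)) = 1 ⊗ₜ φ x := by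
  have h := congrArg ((LinearMap.mul' K H ∘ₗ TensorProduct.map φ ψ ∘ₗ
    (TensorProduct.comm K H H).toLinearMap).rTensor H ∘ₗ
    φ.lTensor (H ⊗[K] H) ∘ₗ (TensorProduct.assoc K H H H).symm.toLinearMap)
    (sum_tmul_tmul_eq (ℛ K x) (fun i => ℛ K ((ℛ K x).left i)) (fun i => ℛ K ((ℛ K x).right i)))
  simp only [map_sum, LinearMap.comp_apply, LinearEquiv.coe_coe, TensorProduct.assoc_symm_tmul,
    LinearMap.rTensor_tmul, LinearMap.lTensor_tmul, TensorProduct.comm_tmul,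
    TensorProduct.map_tmul, LinearMap.mul'_apply] at h
  have hψ' : ∀ y : H, ∑ i ∈ (ℛ K y).index, φ ((ℛ K y).right i) * ψ ((ℛ K y).left i) =
      counit (R := K) y • 1 := fun y => by
    rw [← hψ]
    conv_rhs => rw [← (ℛ K y).eq]
    simp
  calc _ = _ := by
        refine Finset.sum_congr rfl fun i _ => ?_
        rw [hφ]
        conv_lhs => rw [← (ℛ K ((ℛ K x).right i)).eq]
        rw [map_sum, Finset.sum_mul]
        simp only [TensorProduct.map_tmul, Algebra.TensorProduct.tmul_mul_tmul, mul_one]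
    _ = _ := h.symm
    _ = _ := by
        simp only [← TensorProduct.sum_tmul, hψ', TensorProduct.smul_tmul]
        rw [← TensorProduct.tmul_sum]
        simp only [← map_smul, ← map_sum, sum_counit_smul]

variable [FiniteDimensional K H]

/-- `f(x y) = f₁(x) f₂(y)` -/
lemma comp_mulRight_eq_sum (f : HopfDual K H) (y : H) :
    HopfDual.toDual K H f ∘ₗ LinearMap.mulRight K y =
      ∑ j ∈ (ℛ K f).index, ((ℛ K f).right j) y • HopfDual.toDual K H ((ℛ K f).left j) := by
  ext x
  have h : HopfDual.pairEquiv K H (comul f) (x ⊗ₜ y) = f (x * y) :=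
    HopfDual.pairEquiv_comulMap f (x ⊗ₜ y)
  rw [← (ℛ K f).eq, map_sum, LinearMap.sum_apply] at h
  simp only [HopfDual.pairEquiv_tmul] at h
  simp only [LinearMap.comp_apply, LinearMap.mulRight_apply, ← h, LinearMap.sum_apply,
    LinearMap.smul_apply, smul_eq_mul, mul_comm]

/-- Let `φ` be a coalgebra map with `φ(x₂) ψ(x₁) = ε(x)`. A form `f` with `f(x₁ ψ(x₂)) = ε(x) f(1)`
multiplies the trace form of `φ` by `f(1)`. The product `f * traceForm φ` at `x` is the trace of
`y ↦ f(x₁) x₂ φ(y)`; writing `1 ⊗ φ(y)` as `Δ(φ(y₂)) (ψ(y₁) ⊗ 1)`, this operator becomes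
`hit f₁ ∘ (y ↦ x φ(y)) ∘ hit (f₂ ∘ ψ)`, and by cyclicity of the trace the two outer operators
combine to `hit (f₁ * (f₂ ∘ ψ))`, the multiplication by `f(1)`. -/
theorem mul_traceForm {φ ψ : H →ₗ[K] H}
    (hφ : ∀ x, comul (R := K) (φ x) = TensorProduct.map φ φ (comul x))
    (hψ : ∀ x, LinearMap.mul' K H
      (TensorProduct.map φ ψ (TensorProduct.comm K H H (comul x))) = counit (R := K) x • 1)
    {f : HopfDual K H}
    (hf : ∀ x, f (LinearMap.mul' K H (ψ.lTensor H (comul x))) = counit (R := K) x * f 1) :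
    f * traceForm φ = f 1 • traceForm φ := by
  ext x
  have key : ∀ s : H ⊗[K] H,
      LinearMap.mul' K K (TensorProduct.map (HopfDual.toDual K H f)
        (HopfDual.toDual K H (traceForm φ)) s) =
      LinearMap.trace K H (contractLeft (HopfDual.toDual K H f) ∘ₗ LinearMap.mulLeft K s ∘ₗ
        TensorProduct.mk K H H 1 ∘ₗ φ) := by
    intro s
    induction s with
    | zero => simp
    | add a b ha hb =>
      rw [map_add, map_add, ha, hb, ← map_add]
      congr 1
      ext y
      simp [add_mul]
    | tmul a b =>
      rw [TensorProduct.map_tmul, LinearMap.mul'_apply, traceForm_apply, ← smul_eq_mul, ← map_smul]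
      congr 1
      ext y
      simp
  rw [HopfDual.mul_apply, key]
  set R := ℛ K f
  let g : HopfDual K H × HopfDual K H → HopfDual K H := fun j =>
    (HopfDual.toDual K H).symm (HopfDual.toDual K H (R.right j) ∘ₗ ψ)
  have hop : contractLeft (HopfDual.toDual K H f) ∘ₗ LinearMap.mulLeft K (comul x) ∘ₗ
        TensorProduct.mk K H H 1 ∘ₗ φ =
      ∑ j ∈ R.index, hit (R.left j) ∘ₗ (LinearMap.mulLeft K x ∘ₗ φ) ∘ₗ hit (g j) := by
    ext y
    simp only [LinearMap.comp_apply, LinearMap.mulLeft_apply, TensorProduct.mk_apply,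
      LinearMap.sum_apply]
    rw [← sum_comul_mul_tmul_one hφ hψ, Finset.mul_sum, map_sum]
    simp only [← mul_assoc, ← Bialgebra.comul_mul, contractLeft_mul_tmul_one,
      comp_mulRight_eq_sum, contractLeft_sum, contractLeft_smul]
    rw [Finset.sum_comm]
    refine Finset.sum_congr rfl fun j _ => ?_
    simp only [hit, LinearMap.comp_apply]
    conv_rhs => rw [← (ℛ K y).eq]
    simp only [map_sum, contractLeft_tmul, map_smul, Finset.mul_sum, mul_smul_comm]
    rfl
  have hsum : ∑ j ∈ R.index, R.left j * g j = f 1 • 1 := by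
    ext y
    rw [map_smul, LinearMap.smul_apply, HopfDual.one_apply, smul_eq_mul, mul_comm, ← hf, map_sum,
      LinearMap.sum_apply]
    conv_rhs => rw [← (ℛ K y).eq]
    simp only [HopfDual.mul_apply]
    have : ∀ j ∈ R.index, LinearMap.mul' K K (TensorProduct.map (HopfDual.toDual K H (R.left j))
        (HopfDual.toDual K H (g j)) (comul y)) = ∑ i ∈ (ℛ K y).index,
          R.left j ((ℛ K y).left i) * R.right j (ψ ((ℛ K y).right i)) := by
      intro j _
      conv_lhs => rw [← (ℛ K y).eq]
      simp only [map_sum, TensorProduct.map_tmul, LinearMap.mul'_apply]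
      rfl
    rw [Finset.sum_congr rfl this, Finset.sum_comm]
    simp only [map_sum, LinearMap.lTensor_tmul, LinearMap.mul'_apply]
    refine Finset.sum_congr rfl fun i _ => ?_
    have := LinearMap.congr_fun (comp_mulRight_eq_sum f (ψ ((ℛ K y).right i))) ((ℛ K y).left i)
    simp only [LinearMap.comp_apply, LinearMap.mulRight_apply, LinearMap.sum_apply,
      LinearMap.smul_apply, smul_eq_mul] at this
    rw [this]
    exact Finset.sum_congr rfl fun j _ => mul_comm _ _
  rw [hop, map_sum]
  have htr : ∀ j ∈ R.index,
      LinearMap.trace K H (hit (R.left j) ∘ₗ (LinearMap.mulLeft K x ∘ₗ φ) ∘ₗ hit (g j)) =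
        LinearMap.trace K H ((LinearMap.mulLeft K x ∘ₗ φ) ∘ₗ hit (R.left j * g j)) := fun j _ => by
    rw [← hit_comp_hit, LinearMap.trace_comp_comm', LinearMap.comp_assoc]
  have hcomp : ∑ j ∈ R.index, (LinearMap.mulLeft K x ∘ₗ φ) ∘ₗ hit (R.left j * g j) =
      (LinearMap.mulLeft K x ∘ₗ φ) ∘ₗ ∑ j ∈ R.index, hit (R.left j * g j) := by
    ext
    simp
  rw [Finset.sum_congr rfl htr, ← map_sum, hcomp, ← hit_sum, hsum, hit_smul, hit_one,
    LinearMap.comp_smul, LinearMap.comp_id, map_smul, map_smul, LinearMap.smul_apply,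
    traceForm_apply]

end TraceForm

/-! ### Traces of automorphisms of finite order -/

section Positivity

open Module

variable {K : Type u} [Field K]

lemma trace_eq_sum_of_apply_basis {V ι : Type*} [AddCommGroup V] [Module K V] [Fintype ι]
    (b : Basis ι K V) {f : End K V} {c : ι → K} (h : ∀ i, f (b i) = c i • b i) :
    LinearMap.trace K V f = ∑ i, c i := by
  classical
  rw [LinearMap.trace_eq_matrix_trace K b, Matrix.trace]
  refine Finset.sum_congr rfl fun i _ => ?_
  rw [Matrix.diag_apply, LinearMap.toMatrix_apply, h]
  simp

lemma trace_pi {ι : Type*} [Fintype ι] [DecidableEq ι] {M : ι → Type*} [∀ i, AddCommGroup (M i)]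
    [∀ i, Module K (M i)] [∀ i, FiniteDimensional K (M i)] (F : End K (∀ i, M i)) :
    LinearMap.trace K _ F =
      ∑ i, LinearMap.trace K (M i) (LinearMap.proj i ∘ₗ F ∘ₗ LinearMap.single K M i) := by
  have hid : F = ∑ i, (F ∘ₗ LinearMap.single K M i) ∘ₗ LinearMap.proj i := by
    refine LinearMap.ext fun x => ?_
    rw [LinearMap.sum_apply]
    conv_lhs => rw [← Finset.univ_sum_single x, map_sum]
    rfl
  conv_lhs => rw [hid, map_sum]
  exact Finset.sum_congr rfl fun i _ => LinearMap.trace_comp_comm' _ _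

/-- An endomorphism of finite order is diagonalizable, its eigenvalues being roots of unity. -/
lemma exists_trace_eq_sum_rootsOfUnity [IsAlgClosed K] [CharZero K] {V : Type v} [AddCommGroup V]
    [Module K V] [FiniteDimensional K V] {a b : End K V} (hab : b * a = 1) {N : ℕ} (hN : 0 < N)
    (ha : a ^ N = 1) :
    ∃ (ι : Type v) (_ : Fintype ι) (c : ι → K), (∀ i, c i ^ N = 1) ∧
      LinearMap.trace K V a = ∑ i, c i ∧ LinearMap.trace K V b = ∑ i, (c i)⁻¹ := by
  have hss : a.IsSemisimple := by
    refine End.isSemisimple_of_squarefree_aeval_eq_zero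
      (p := Polynomial.X ^ N - Polynomial.C 1) ?_ (by simp [ha])
    exact (Polynomial.separable_X_pow_sub_C (1 : K) (by exact_mod_cast hN.ne')
      one_ne_zero).squarefree
  let s : Set V := {x | ∃ μ : K, a x = μ • x}
  have hs : ⊤ ≤ Submodule.span K s := by
    rw [← hss.iSup_eigenspace_eq_top]
    refine iSup_le fun μ x hx => Submodule.subset_span ⟨μ, End.mem_eigenspace_iff.1 hx⟩
  let B := Basis.ofSpan hs
  have hB : ∀ i, ∃ μ : K, a (B i) = μ • B i := fun i => Basis.ofSpan_subset hs ⟨i, rfl⟩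
  choose c hc using hB
  have : Finite ↑((linearIndepOn_empty K id).extend (Set.empty_subset s)) :=
    Module.Finite.finite_basis B
  have : Fintype ↑((linearIndepOn_empty K id).extend (Set.empty_subset s)) := Fintype.ofFinite _
  have hpow : ∀ i (n : ℕ), (a ^ n) (B i) = c i ^ n • B i := by
    intro i n
    induction n with
    | zero => simp
    | succ n ih => rw [pow_succ', Module.End.mul_apply, ih, map_smul, hc, smul_smul, pow_succ]
  have hcN : ∀ i, c i ^ N = 1 := fun i => by
    have h := hpow i N
    rw [ha, Module.End.one_apply] at h
    have h2 : (c i ^ N - 1) • B i = 0 := by rw [sub_smul, ← h, one_smul, sub_self]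
    exact sub_eq_zero.1 ((smul_eq_zero.1 h2).resolve_right (B.ne_zero i))
  have hc0 : ∀ i, c i ≠ 0 := fun i h => by
    have := hcN i
    rw [h, zero_pow hN.ne'] at this
    exact zero_ne_one this
  refine ⟨_, inferInstance, c, hcN, trace_eq_sum_of_apply_basis B hc,
    trace_eq_sum_of_apply_basis B fun i => ?_⟩
  have h : b (a (B i)) = B i := by rw [← Module.End.mul_apply, hab, Module.End.one_apply]
  rw [hc, map_smul] at h
  rw [eq_inv_smul_iff₀ (hc0 i), h]

/-- The trace of `X ↦ A X B` on square matrices is `Tr A * Tr B`. -/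
lemma trace_mulLeft_mulRight {n : Type*} [Fintype n] [DecidableEq n] (A B : Matrix n n K) :
    LinearMap.trace K (Matrix n n K) (LinearMap.mulLeft K A ∘ₗ LinearMap.mulRight K B) =
      A.trace * B.trace := by
  rw [LinearMap.trace_eq_matrix_trace K (Matrix.stdBasis K n n), Matrix.trace,
    Fintype.sum_prod_type, Matrix.trace, Matrix.trace, Finset.sum_mul_sum]
  refine Finset.sum_congr rfl fun i _ => Finset.sum_congr rfl fun j _ => ?_
  rw [Matrix.diag_apply, LinearMap.toMatrix_apply, Matrix.stdBasis_eq_single]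
  simp only [LinearMap.comp_apply, LinearMap.mulLeft_apply, LinearMap.mulRight_apply,
    ← Matrix.mul_assoc]
  have hrepr : ∀ M : Matrix n n K, (Matrix.stdBasis K n n).repr M (i, j) = M i j := fun M => by
    simp [Matrix.stdBasis]
  rw [hrepr, Matrix.mul_apply, Finset.sum_eq_single j]
  · simp [Matrix.diag_apply]
  · intro k _ hk
    simp [Matrix.mul_apply, hk.symm]
  · simp

/-- Automorphisms of a matrix algebra are inner. -/
lemma exists_conj_of_algEquiv {n : Type*} [Fintype n] [DecidableEq n]
    (τ : Matrix n n K ≃ₐ[K] Matrix n n K) :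
    ∃ A B : Matrix n n K, A * B = 1 ∧ B * A = 1 ∧ ∀ X, τ X = A * X * B := by
  let e : Matrix n n K ≃ₐ[K] End K (n → K) := Matrix.toLinAlgEquiv'
  obtain ⟨T, hT⟩ := ((e.symm.trans τ).trans e).eq_linearEquivConjAlgEquiv
  refine ⟨e.symm T.toLinearMap, e.symm T.symm.toLinearMap, ?_, ?_, fun X => ?_⟩
  · rw [← map_mul, ← map_one e.symm]; congr 1; ext; simp
  · rw [← map_mul, ← map_one e.symm]; congr 1; ext; simp
  · apply e.injective
    have := AlgEquiv.congr_fun hT (e X)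
    simp only [AlgEquiv.trans_apply, AlgEquiv.symm_apply_apply] at this
    rw [this, map_mul, map_mul, AlgEquiv.apply_symm_apply, AlgEquiv.apply_symm_apply]
    rfl

/-- The trace of an automorphism of finite order of a matrix algebra is of the form
`(∑ c) (∑ c⁻¹)` with roots of unity `c`. -/
lemma exists_trace_algEquiv [IsAlgClosed K] [CharZero K] {d : ℕ} [NeZero d]
    (τ : Matrix (Fin d) (Fin d) K ≃ₐ[K] Matrix (Fin d) (Fin d) K) {N : ℕ} (hN : 0 < N)
    (hτ : ∀ X, τ^[N] X = X) :
    ∃ (ι : Type u) (_ : Fintype ι) (c : ι → K), (∀ i, c i ^ N = 1) ∧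
      LinearMap.trace K _ τ.toLinearMap = (∑ i, c i) * ∑ i, (c i)⁻¹ := by
  obtain ⟨A, B, hAB, hBA, hτA⟩ := exists_conj_of_algEquiv τ
  have hit : ∀ (n : ℕ) X, τ^[n] X = A ^ n * X * B ^ n := by
    intro n
    induction n with
    | zero => simp
    | succ n ih =>
      intro X
      rw [Function.iterate_succ_apply', ih, hτA, pow_succ', pow_succ]
      noncomm_ring
  have hBAn : ∀ n : ℕ, B ^ n * A ^ n = 1 := by
    intro n
    induction n with
    | zero => simp
    | succ n ih => rw [pow_succ, pow_succ', mul_assoc, ← mul_assoc B A, hBA, one_mul, ih]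
  have hcomm : ∀ X, A ^ N * X = X * A ^ N := fun X => by
    have h := hτ X
    rw [hit] at h
    conv_rhs => rw [← h]
    rw [mul_assoc _ (B ^ N), hBAn, mul_one]
  obtain ⟨c, hc⟩ : ∃ c : K, A ^ N = Matrix.scalar (Fin d) c := by
    have := (Matrix.mem_range_scalar_iff_commute_single (M := A ^ N)).2
      fun i j _ => (hcomm _).symm
    obtain ⟨c, hc⟩ := this
    exact ⟨c, hc.symm⟩
  have hc0 : c ≠ 0 := by
    rintro rfl
    have h := hBAn N
    rw [hc, map_zero, mul_zero] at h
    exact zero_ne_one h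
  -- rescale the conjugating matrix, whose `N`-th power is the scalar `c`, to have finite order
  obtain ⟨r, hr⟩ := IsAlgClosed.exists_pow_nat_eq c hN
  have hr0 : r ≠ 0 := by
    rintro rfl
    rw [zero_pow hN.ne'] at hr
    exact hc0 hr.symm
  let e : Matrix (Fin d) (Fin d) K ≃ₐ[K] End K (Fin d → K) := Matrix.toLinAlgEquiv'
  have h1 : e (r • B) * e (r⁻¹ • A) = 1 := by
    rw [← map_mul, smul_mul_smul_comm, hBA, mul_inv_cancel₀ hr0, one_smul, map_one]
  have h2 : e (r⁻¹ • A) ^ N = 1 := by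
    rw [← map_pow, smul_pow, hc, inv_pow, hr, Matrix.scalar_apply]
    rw [← map_one e]
    congr 1
    ext i j
    simp [Matrix.diagonal_apply, Matrix.one_apply, hc0]
  obtain ⟨ι, hι, c', hc', ha, hb⟩ := exists_trace_eq_sum_rootsOfUnity h1 hN h2
  refine ⟨ι, hι, c', hc', ?_⟩
  have htr : ∀ M, LinearMap.trace K (Fin d → K) (e M) = M.trace := fun M =>
    Matrix.trace_toLin'_eq M
  rw [← ha, ← hb, htr, htr, Matrix.trace_smul, Matrix.trace_smul, smul_mul_smul_comm,
    inv_mul_cancel₀ hr0, one_smul, ← trace_mulLeft_mulRight]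
  congr 1
  ext1 X
  simp only [AlgEquiv.toLinearMap_apply, LinearMap.comp_apply, LinearMap.mulLeft_apply,
    LinearMap.mulRight_apply, hτA, mul_assoc]

/-- Sums `∑ (∑ c) (∑ c⁻¹)` over families of roots of unity are sums of squares of absolute values
of complex numbers, so they vanish only if each term does. -/
lemma eq_zero_of_sum_mul_sum_inv_eq_zero [CharZero K] {β : Type*} [Fintype β] {ι : β → Type*}
    [∀ b, Fintype (ι b)] (c : ∀ b, ι b → K) {N : ℕ} (hN : 0 < N) (hc : ∀ b i, c b i ^ N = 1)
    (h : ∑ b, (∑ i, c b i) * ∑ i, (c b i)⁻¹ = 0) (b : β) :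
    (∑ i, c b i) * ∑ i, (c b i)⁻¹ = 0 := by
  -- embed the algebraic numbers of `K` into `ℂ`, where inverting a root of unity is conjugation
  let F := algebraicClosure ℚ K
  have : Algebra.IsAlgebraic ℚ F := algebraicClosure.isAlgebraic ℚ K
  let j : F →ₐ[ℚ] ℂ := IsAlgClosed.lift
  have halg : ∀ b i, c b i ∈ F := fun b i => by
    rw [mem_algebraicClosure_iff]
    exact ⟨Polynomial.X ^ N - 1, (Polynomial.monic_X_pow_sub_C 1 hN.ne').ne_zero, by simp [hc]⟩
  let z : ∀ b, ι b → F := fun b i => ⟨c b i, halg b i⟩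
  have hz : ∀ b i, z b i ^ N = 1 := fun b i => Subtype.ext (hc b i)
  have hconj : ∀ b i, j (z b i)⁻¹ = (starRingEnd ℂ) (j (z b i)) := fun b i => by
    have : (j (z b i)) ^ N = 1 := by rw [← map_pow, hz, map_one]
    have h1 := Complex.norm_eq_one_of_pow_eq_one this hN.ne'
    rw [map_inv₀, Complex.inv_eq_conj h1]
  have hterm : ∀ b, j ((∑ i, z b i) * ∑ i, (z b i)⁻¹) = (Complex.normSq (∑ i, j (z b i)) : ℂ) := by
    intro b
    rw [map_mul, map_sum, map_sum, Complex.normSq_eq_conj_mul_self, map_sum, mul_comm]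
    congr 1
    exact Finset.sum_congr rfl fun i _ => hconj b i
  have hzero : ∑ b, (∑ i, z b i) * ∑ i, (z b i)⁻¹ = 0 := by
    apply Subtype.ext
    simpa [z] using h
  have h3 := congrArg j hzero
  rw [map_sum, map_zero] at h3
  simp only [hterm] at h3
  rw [← Complex.ofReal_sum, Complex.ofReal_eq_zero,
    Finset.sum_eq_zero_iff_of_nonneg fun b _ => Complex.normSq_nonneg _] at h3
  have h4 := hterm b
  rw [h3 b (Finset.mem_univ b), Complex.ofReal_zero, map_eq_zero] at h4
  have := congrArg (algebraMap F K) h4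
  simpa [z] using this

/-- Let `σ` be an automorphism of finite order of a semisimple algebra which fixes the centre. If
`σ` composed with the multiplication by some central element has nonzero trace, then so has `σ`. -/
theorem trace_ne_zero_of_central [IsAlgClosed K] [CharZero K] {A : Type v} [Ring A] [Algebra K A]
    [FiniteDimensional K A] [IsSemisimpleRing A] (σ : A ≃ₐ[K] A)
    (hσ : ∀ z : A, (∀ x, z * x = x * z) → σ z = z) {N : ℕ} (hN : 0 < N) (hσN : ∀ x, σ^[N] x = x)
    {t : A} (ht : ∀ x, t * x = x * t)
    (htr : LinearMap.trace K A (σ.toLinearMap ∘ₗ LinearMap.mulLeft K t) ≠ 0) :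
    LinearMap.trace K A σ.toLinearMap ≠ 0 := by
  obtain ⟨n, d, hd, ⟨φ⟩⟩ := IsSemisimpleRing.exists_algEquiv_pi_matrix_of_isAlgClosed K A
  let M := fun i : Fin n => Matrix (Fin (d i)) (Fin (d i)) K
  let τ : (∀ i, M i) ≃ₐ[K] (∀ i, M i) := (φ.symm.trans σ).trans φ
  -- `σ` fixes the central idempotents, so that it preserves every block
  have hτ1 : ∀ i, τ (Pi.single i 1) = Pi.single i 1 := by
    intro i
    change φ (σ (φ.symm _)) = _
    rw [hσ, φ.apply_symm_apply]
    intro x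
    apply φ.injective
    rw [map_mul, map_mul, φ.apply_symm_apply]
    ext1 k
    by_cases hk : k = i
    · subst hk; simp
    · simp [hk]
  have hτN : ∀ x, τ^[N] x = x := by
    have : ∀ (m : ℕ) x, τ^[m] x = φ (σ^[m] (φ.symm x)) := by
      intro m
      induction m with
      | zero => simp
      | succ m ih =>
        intro x
        rw [Function.iterate_succ_apply', ih, Function.iterate_succ_apply']
        simp [τ]
    intro x
    rw [this, hσN, φ.apply_symm_apply]
  have hτs : ∀ i (X : M i), τ (Pi.single i X) = Pi.single i (τ (Pi.single i X) i) := by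
    intro i X
    have h : (Pi.single i X : ∀ i, M i) = Pi.single i 1 * Pi.single i X := by
      rw [← Pi.single_mul, one_mul]
    conv_lhs => rw [h, map_mul, hτ1]
    ext1 k
    by_cases hk : k = i
    · subst hk; simp
    · simp [hk]
  let τi : ∀ i, M i →ₐ[K] M i := fun i =>
    { toFun := fun X => τ (Pi.single i X) i
      map_one' := by simp [hτ1]
      map_mul' := fun X Y => by rw [Pi.single_mul, map_mul]; rfl
      map_zero' := by simp
      map_add' := fun X Y => by rw [Pi.single_add, map_add]; rfl
      commutes' := fun c => by
        have h : (Pi.single i (algebraMap K (M i) c) : ∀ i, M i) = c • Pi.single i 1 := by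
          rw [← Pi.single_smul, Algebra.algebraMap_eq_smul_one]
        rw [h, map_smul, hτ1, Pi.smul_apply, Pi.single_eq_same, Algebra.algebraMap_eq_smul_one] }
  have hτi : ∀ i X, τ (Pi.single i X) = Pi.single i (τi i X) := hτs
  have hinj : ∀ i, Function.Injective (τi i) := fun i X Y h => by
    apply Pi.single_injective (M := M) i
    apply τ.injective
    rw [hτi, hτi, h]
  let τe : ∀ i, M i ≃ₐ[K] M i := fun i => AlgEquiv.ofBijective (τi i)
    ⟨hinj i, (LinearMap.injective_iff_surjective (f := (τi i).toLinearMap)).1 (hinj i)⟩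
  have hτe : ∀ i X, τ (Pi.single i X) = Pi.single i (τe i X) := hτs
  have hτeN : ∀ i X, (τe i)^[N] X = X := by
    have : ∀ i (m : ℕ) X, τ^[m] (Pi.single i X) = Pi.single i ((τe i)^[m] X) := by
      intro i m
      induction m with
      | zero => simp
      | succ m ih =>
        intro X
        rw [Function.iterate_succ_apply', ih, Function.iterate_succ_apply', hτe]
    intro i X
    apply Pi.single_injective (M := M) i
    rw [← this, hτN]
  choose ι hι c hc htrc using fun i => exists_trace_algEquiv (τe i) hN (hτeN i)
  -- the trace of `σ` composed with a central element which acts by the scalar `s i` on block `i`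
  have hblock : ∀ (z : A) (s : Fin n → K), (∀ i, φ z i = s i • 1) →
      LinearMap.trace K A (σ.toLinearMap ∘ₗ LinearMap.mulLeft K z) =
        ∑ i, s i * ((∑ k, c i k) * ∑ k, (c i k)⁻¹) := by
    intro z s hs
    rw [← LinearMap.trace_conj' _ φ.toLinearEquiv]
    set F := φ.toLinearEquiv.conj (σ.toLinearMap ∘ₗ LinearMap.mulLeft K z)
    have hF : ∀ x, F x = τ (φ z * x) := fun x => by
      simp [F, LinearEquiv.conj_apply, τ]
    rw [trace_pi]
    refine Finset.sum_congr rfl fun i _ => ?_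
    rw [← htrc, ← smul_eq_mul, ← map_smul]
    congr 1
    ext1 X
    have h : (φ z * Pi.single i X : ∀ i, M i) = Pi.single i (s i • X) := by
      ext1 k
      by_cases hk : k = i
      · subst hk; simp [hs]
      · simp [hk]
    simp only [LinearMap.comp_apply, LinearMap.proj_apply, LinearMap.coe_single, hF, h, hτe,
      Pi.single_eq_same, map_smul, LinearMap.smul_apply, AlgEquiv.toLinearMap_apply]
  -- if `Tr σ` vanishes, then so does its contribution from each block
  intro h0
  have h1 := hblock 1 (fun _ => 1) (fun i => by rw [map_one, one_smul]; rfl)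
  rw [LinearMap.mulLeft_one, LinearMap.comp_id, h0] at h1
  simp only [one_mul] at h1
  have h2 := eq_zero_of_sum_mul_sum_inv_eq_zero c hN hc h1.symm
  have hs : ∀ i, ∃ s : K, φ t i = s • 1 := by
    intro i
    obtain ⟨s, hs⟩ := (Matrix.mem_range_scalar_iff_commute_single (M := φ t i)).2
      fun k l _ => by
        have h := congrArg φ (ht (φ.symm (Pi.single i (Matrix.single k l 1))))
        rw [map_mul, map_mul, φ.apply_symm_apply] at h
        have := congrFun h i
        simp only [Pi.mul_apply, Pi.single_eq_same] at this
        exact this.symm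
    exact ⟨s, by rw [← hs, Matrix.scalar_apply, Matrix.smul_one_eq_diagonal]⟩
  choose s hs using hs
  apply htr
  rw [hblock t s hs]
  exact Finset.sum_eq_zero fun i _ => by rw [h2, mul_zero]

end Positivity

/-! ### Averaging over an integral and Maschke's theorem -/

section Averaging

variable {K : Type u} {A : Type v} [Field K] [Ring A] [HopfAlgebra K A]
variable {W : Type w} [AddCommGroup W] [Module K W] [Module A W] [IsScalarTower K A W]

/-- The linear map `a ⊗ b ↦ ρ(a) ∘ B ∘ ρ(S(b))`, where `ρ` is the action of `A` on `W`. -/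
noncomputable def casimirMap (B : Module.End K W) : A ⊗[K] A →ₗ[K] Module.End K W :=
  TensorProduct.lift (LinearMap.mk₂ K
    (fun a b => Algebra.lsmul K K W a * B * Algebra.lsmul K K W (antipode K b))
    (fun a a' b => by simp [add_mul]) (fun c a b => by simp)
    (fun a b b' => by simp [mul_add]) (fun c a b => by simp))

lemma casimirMap_tmul (B : Module.End K W) (a b : A) :
    casimirMap B (a ⊗ₜ[K] b) = Algebra.lsmul K K W a * B * Algebra.lsmul K K W (antipode K b) := rfl

lemma casimirMap_tmul_apply (B : Module.End K W) (a b : A) (x : W) :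
    casimirMap B (a ⊗ₜ[K] b) x = a • B (antipode K b • x) := rfl

/-- Averaging an endomorphism with a left integral gives a module endomorphism. -/
lemma casimirMap_comul_smul {t : A} (ht : ∀ y : A, y * t = counit (R := K) y • t)
    (hS : Function.Surjective (antipode K : A →ₗ[K] A)) (B : Module.End K W) (y : A) (x : W) :
    casimirMap B (comul (R := K) t) (y • x) = y • casimirMap B (comul (R := K) t) x := by
  obtain ⟨y, rfl⟩ := hS y
  have h1 : ∀ s : A ⊗[K] A, casimirMap B (((1 : A) ⊗ₜ[K] y) * s) x =
      casimirMap B s (antipode K y • x) := by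
    intro s
    induction s with
    | zero => simp
    | add a b ha hb => simp only [mul_add, map_add, LinearMap.add_apply, ha, hb]
    | tmul a b =>
      rw [Algebra.TensorProduct.tmul_mul_tmul, one_mul, casimirMap_tmul_apply,
        casimirMap_tmul_apply, antipode_mul_antidistrib, mul_smul]
  have h2 : ∀ s : A ⊗[K] A, casimirMap B ((antipode K y ⊗ₜ[K] (1 : A)) * s) x =
      antipode K y • casimirMap B s x := by
    intro s
    induction s with
    | zero => simp
    | add a b ha hb => simp only [mul_add, map_add, LinearMap.add_apply, ha, hb, smul_add]
    | tmul a b =>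
      rw [Algebra.TensorProduct.tmul_mul_tmul, one_mul, casimirMap_tmul_apply,
        casimirMap_tmul_apply, mul_smul]
  rw [← h1, ← h2, one_tmul_mul_comul ht]

/-- Maschke's theorem for Hopf algebras: averaging a linear projection onto a left ideal gives a
module projection. -/
theorem isSemisimpleRing_of_integral {t : A} (ht : ∀ y : A, y * t = counit (R := K) y • t)
    (hS : Function.Surjective (antipode K : A →ₗ[K] A)) (ht0 : counit (R := K) t ≠ 0) :
    IsSemisimpleRing A := by
  refine (isSemisimpleModule_iff A A).2 ⟨fun N => ?_⟩
  let N' : Submodule K A := N.restrictScalars K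
  obtain ⟨p, hp⟩ := LinearMap.exists_leftInverse_of_injective N'.subtype
    (LinearMap.ker_eq_bot.2 N'.injective_subtype)
  have hpN : ∀ x ∈ N, N'.subtype (p x) = x := fun x hx =>
    congrArg N'.subtype (LinearMap.congr_fun hp (⟨x, hx⟩ : N'))
  let B : Module.End K A := N'.subtype ∘ₗ p
  have hmem : ∀ (s : A ⊗[K] A) x, casimirMap B s x ∈ N := by
    intro s x
    induction s with
    | zero => simp
    | add a b ha hb => rw [map_add, LinearMap.add_apply]; exact N.add_mem ha hb
    | tmul a b => exact N.smul_mem _ (p _).2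
  have hid : ∀ (s : A ⊗[K] A) x, x ∈ N → casimirMap B s x =
      LinearMap.mul' K A ((antipode K (A := A)).lTensor A s) * x := by
    intro s x hx
    induction s with
    | zero => simp
    | add a b ha hb => rw [map_add, LinearMap.add_apply, ha, hb]; simp [add_mul]
    | tmul a b =>
      rw [casimirMap_tmul_apply]
      change a • N'.subtype (p (antipode K b • x)) = _
      rw [hpN _ (N.smul_mem _ hx)]
      simp [mul_assoc]
  let q : A →ₗ[A] N :=
    { toFun := fun x => ⟨(counit (R := K) t)⁻¹ • casimirMap B (comul (R := K) t) x,
        (N.restrictScalars K).smul_mem _ (hmem _ _)⟩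
      map_add' := fun x y => Subtype.ext (by simp)
      map_smul' := fun a x => Subtype.ext (by
        change _ • casimirMap B (comul (R := K) t) (a • x) = a • _ • _
        rw [casimirMap_comul_smul ht hS, smul_comm]) }
  refine ⟨LinearMap.ker q, LinearMap.isCompl_of_proj fun x => Subtype.ext ?_⟩
  change (counit (R := K) t)⁻¹ • casimirMap B (comul (R := K) t) x = x
  rw [hid _ _ x.2, mul_antipode_lTensor_comul_apply, Algebra.algebraMap_eq_smul_one, smul_mul_assoc,
    one_mul, smul_smul, inv_mul_cancel₀ ht0, one_smul]

end Averaging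

/-! ### The bidual -/

section Bidual

variable {K : Type u} {H : Type v} [Field K] [Ring H] [HopfAlgebra K H]

lemma antipode_dual_apply [FiniteDimensional K H] (f : HopfDual K H) (x : H) :
    (antipode K f) x = f (antipode K x) := rfl

lemma antipode_dual_surjective [FiniteDimensional K H]
    (hS : Function.Injective (antipode K : H →ₗ[K] H)) :
    Function.Surjective (antipode K : HopfDual K H →ₗ[K] HopfDual K H) := by
  apply LinearMap.surjective_of_injective
  intro f g h
  ext x
  obtain ⟨y, rfl⟩ := LinearMap.surjective_of_injective hS x
  exact congrArg (fun k : HopfDual K H => k y) h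

/-- The square of the antipode is a coalgebra map, as the transpose of the square of the antipode of
`H^*`, which is an algebra map. -/
lemma comul_antipode_antipode [FiniteDimensional K H] (x : H) :
    comul (R := K) (antipode K (antipode K x)) =
      TensorProduct.map (antipode K ∘ₗ antipode K) (antipode K ∘ₗ antipode K)
        (comul (R := K) x) := by
  rw [← sub_eq_zero, ← Module.forall_dual_apply_eq_zero_iff K]
  intro φ
  obtain ⟨s, rfl⟩ := (HopfDual.pairEquiv K H).surjective φ
  rw [map_sub, sub_eq_zero]
  induction s with
  | zero => simp
  | add a b ha hb => simp only [map_add, LinearMap.add_apply, ha, hb]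
  | tmul f g =>
    rw [← HopfDual.mul_eq, ← antipode_dual_apply, ← antipode_dual_apply,
      antipode_mul_antidistrib, antipode_mul_antidistrib, HopfDual.mul_eq]
    induction (comul (R := K) x) with
    | zero => simp
    | add a b ha hb => simp only [map_add, ha, hb]
    | tmul a b => rfl

variable (K H) in
/-- The evaluation isomorphism from `H` to its bidual. -/
noncomputable def bidualEquiv [FiniteDimensional K H] :
    H ≃ₗ[K] HopfDual K (HopfDual K H) :=
  ((Module.evalEquiv K H).trans (HopfDual.toDual K H).dualMap).trans
    (HopfDual.toDual K (HopfDual K H)).symm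

lemma lam_eq_traceForm : lam K H = traceForm LinearMap.id := rfl

lemma lam_apply (x : H) : lam K H x = LinearMap.trace K H (LinearMap.mulLeft K x) := rfl

variable [FiniteDimensional K H]

lemma bidualEquiv_apply (x : H) (f : HopfDual K H) : bidualEquiv K H x f = f x := rfl

lemma bidualEquiv_mul (x y : H) :
    bidualEquiv K H x * bidualEquiv K H y = bidualEquiv K H (x * y) := by
  ext f
  rw [HopfDual.mul_apply, bidualEquiv_apply]
  have h : HopfDual.pairEquiv K H (comul f) (x ⊗ₜ y) = f (x * y) :=
    HopfDual.pairEquiv_comulMap f (x ⊗ₜ y)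
  rw [← h]
  induction (comul (R := K) f) with
  | zero => simp
  | add a b ha hb => simp only [map_add, LinearMap.add_apply, ha, hb]
  | tmul a b => rfl

lemma bidualEquiv_ell : bidualEquiv K H (ell K H) = lam K (HopfDual K H) := by
  ext f
  rw [bidualEquiv_apply]
  have := LinearMap.congr_fun ((Module.evalEquiv K H).apply_symm_apply
    (regularCharacter K (HopfDual K H) ∘ₗ (HopfDual.toDual K H).symm.toLinearMap))
    (HopfDual.toDual K H f)
  exact this

lemma apply_ell (f : HopfDual K H) : f (ell K H) = lam K (HopfDual K H) f := by
  rw [← bidualEquiv_ell]; rfl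

end Bidual

/-! ### The regular character -/

section RegularCharacter

lemma regularCharacter_algEquiv {K : Type u} {A : Type v} [Field K] [Ring A] [Algebra K A]
    (σ : A ≃ₐ[K] A) (x : A) : regularCharacter K A (σ x) = regularCharacter K A x := by
  change LinearMap.trace K A (LinearMap.mulLeft K (σ x)) =
    LinearMap.trace K A (LinearMap.mulLeft K x)
  rw [← LinearMap.trace_conj' (LinearMap.mulLeft K x) σ.toLinearEquiv]
  congr 1
  ext y
  simp [LinearEquiv.conj_apply]

variable {K : Type u} {H : Type v} [Field K] [Ring H] [HopfAlgebra K H] [FiniteDimensional K H]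

lemma lam_one : lam K H 1 = (Module.finrank K H : K) := by
  rw [lam_apply, LinearMap.mulLeft_one, LinearMap.trace_id]

lemma lam_mul_comm (x y : H) : lam K H (x * y) = lam K H (y * x) := by
  rw [lam_apply, lam_apply, LinearMap.mulLeft_mul, LinearMap.mulLeft_mul,
    LinearMap.trace_comp_comm']

/-- The regular character of a Hopf algebra with bijective antipode absorbs itself:
`λ² = dim(H) λ`. -/
lemma lam_mul_lam (hS : Function.Bijective (antipode K : H →ₗ[K] H)) :
    lam K H * lam K H = (Module.finrank K H : K) • lam K H := by
  let ψ : H →ₗ[K] H := (LinearEquiv.ofBijective (antipode K : H →ₗ[K] H) hS).symm.toLinearMap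
  have hψ : ∀ x, antipode K (ψ x) = x :=
    (LinearEquiv.ofBijective (antipode K : H →ₗ[K] H) hS).apply_symm_apply
  rw [← lam_one, lam_eq_traceForm]
  refine mul_traceForm (ψ := ψ) (fun x => by simp) (fun x => hS.1 ?_) (fun x => ?_)
  · have h : ∀ s : H ⊗[K] H, antipode K (LinearMap.mul' K H
        (TensorProduct.map LinearMap.id ψ (TensorProduct.comm K H H s))) =
        LinearMap.mul' K H ((antipode K (A := H)).lTensor H s) := by
      intro s
      induction s with
      | zero => simp
      | add a b ha hb => simp only [map_add, ha, hb]
      | tmul a b => simp [antipode_mul_antidistrib, hψ]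
    rw [h, mul_antipode_lTensor_comul_apply, map_smul, antipode_one,
      Algebra.algebraMap_eq_smul_one]
  · have h : ∀ s : H ⊗[K] H, lam K H (LinearMap.mul' K H (ψ.lTensor H s)) =
        lam K H (ψ (LinearMap.mul' K H ((antipode K (A := H)).rTensor H s))) := by
      intro s
      induction s with
      | zero => simp
      | add a b ha hb => simp only [map_add, ha, hb]
      | tmul a b =>
        simp only [LinearMap.lTensor_tmul, LinearMap.rTensor_tmul, LinearMap.mul'_apply]
        rw [lam_mul_comm]
        congr 1
        apply hS.1
        rw [antipode_mul_antidistrib, hψ, hψ]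
    rw [← lam_eq_traceForm, h, mul_antipode_rTensor_comul_apply, Algebra.algebraMap_eq_smul_one,
      map_smul, map_smul, smul_eq_mul]
    congr 2
    apply hS.1
    rw [hψ, antipode_one]

end RegularCharacter

/-! ### Involutions with large trace -/

section LinearAlgebra

variable {K : Type u} {V : Type v} [Field K] [AddCommGroup V] [Module K V]
  [FiniteDimensional K V]

lemma exists_nat_trace_of_isIdempotentElem {P : Module.End K V} (hP : IsIdempotentElem P) :
    ∃ n : ℕ, LinearMap.trace K V P = n :=
  ⟨_, ((LinearMap.isProj_range_iff_isIdempotentElem P).2 hP).trace⟩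

/-- An involution `σ` with an eigenvector for the eigenvalue `1` is the identity, if its trace is
nonzero and is `dim V` times the trace of `P σ` for some projection `P` commuting with `σ`. The
point is that both traces are integers and that `|Tr σ| ≤ dim V`. -/
lemma eq_one_of_trace_eq [CharZero K] {σ P : Module.End K V} (hσ : σ * σ = 1) (hP : P * P = P)
    (hPσ : P * σ = σ * P) (htr : (Module.finrank K V : K) * LinearMap.trace K V (P * σ) =
      LinearMap.trace K V σ) (hne : LinearMap.trace K V σ ≠ 0) {x : V} (hx : x ≠ 0)
    (hσx : σ x = x) : σ = 1 := by
  have h2 : (2 : K) ≠ 0 := two_ne_zero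
  -- the projections onto the eigenspaces for `1` and `-1`, of dimensions `p` and `q` below
  let E : K → Module.End K V := fun c => (2⁻¹ : K) • (1 + c • σ)
  have hE : ∀ c : K, c * c = 1 → E c * E c = E c := by
    intro c hc
    have : (1 + c • σ) * (1 + c • σ) = (2 : K) • (1 + c • σ) := by
      simp only [mul_add, add_mul, one_mul, mul_one, smul_mul_smul_comm, hσ, hc, two_smul, one_smul]
      abel
    simp only [E]
    rw [smul_mul_smul_comm, this, smul_smul, mul_assoc, inv_mul_cancel₀ h2, mul_one]
  have hPE : ∀ c, P * E c = E c * P := fun c => by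
    simp only [E, mul_smul_comm, smul_mul_assoc, mul_add, add_mul, mul_one, one_mul, hPσ]
  have hPE2 : ∀ c : K, c * c = 1 → IsIdempotentElem (P * E c) := fun c hc => by
    change P * E c * (P * E c) = P * E c
    nth_rewrite 1 [hPE]
    rw [mul_assoc, ← mul_assoc P P, hP, hPE, ← mul_assoc, hE c hc]
  have hE1 : (1 : Module.End K V) = E 1 + E (-1) := by
    simp only [E, ← smul_add]
    rw [eq_inv_smul_iff₀ h2, two_smul, one_smul, neg_one_smul]
    abel
  have hE2 : σ = E 1 - E (-1) := by
    simp only [E, ← smul_sub]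
    rw [eq_inv_smul_iff₀ h2, two_smul]
    simp
  obtain ⟨p, hp⟩ := exists_nat_trace_of_isIdempotentElem (hE 1 (by ring))
  obtain ⟨q, hq⟩ := exists_nat_trace_of_isIdempotentElem (hE (-1) (by ring))
  obtain ⟨a, ha⟩ := exists_nat_trace_of_isIdempotentElem (hPE2 1 (by ring))
  obtain ⟨b, hb⟩ := exists_nat_trace_of_isIdempotentElem (hPE2 (-1) (by ring))
  have htσ : LinearMap.trace K V σ = ((p - q : ℤ) : K) := by
    rw [hE2, map_sub, hp, hq]; push_cast; rfl
  have htP : LinearMap.trace K V (P * σ) = ((a - b : ℤ) : K) := by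
    rw [hE2, mul_sub, map_sub, ha, hb]; push_cast; rfl
  have hn : Module.finrank K V = p + q := by
    have := LinearMap.trace_one K V
    rw [hE1, map_add, hp, hq] at this
    exact_mod_cast this.symm
  rw [htσ, htP, hn] at htr
  rw [htσ] at hne
  have hne' : (p - q : ℤ) ≠ 0 := fun h => hne (by rw [h, Int.cast_zero])
  have htr' : ((p + q : ℕ) : ℤ) * (a - b) = p - q := by exact_mod_cast htr
  have hzero : ∀ c : K, c * c = 1 → LinearMap.trace K V (E c) = (0 : ℕ) → E c = 0 := fun c hc h =>
    LinearMap.IsIdempotentElem.eq_zero_of_trace_eq_zero (hE c hc) (by simpa using h)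
  have hab : (a - b : ℤ) ≠ 0 := fun h => hne' (by rw [← htr', h, mul_zero])
  -- the identity `(p + q) (a - b) = p - q ≠ 0` in `ℤ` leaves only the extreme cases
  have hpq : p = 0 ∨ q = 0 := by
    by_contra! hcon
    rcases lt_or_gt_of_ne hab with h | h
    · have : (p - q : ℤ) ≤ -(p + q) := by rw [← htr']; push_cast; nlinarith
      omega
    · have : (p + q : ℤ) ≤ (p - q) := by rw [← htr']; push_cast; nlinarith
      omega
  rcases hpq with rfl | rfl
  · exfalso
    have h0 := hzero 1 (by ring) hp
    have h1 : σ x = -x := by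
      rw [h0, zero_add] at hE1
      rw [hE2, h0, zero_sub, ← hE1]; rfl
    rw [hσx] at h1
    have h3 : (2 : K) • x = 0 := by rw [two_smul]; nth_rewrite 1 [h1]; simp
    exact hx ((smul_eq_zero.1 h3).resolve_left h2)
  · have h0 := hzero (-1) (by ring) hq
    rw [hE2, hE1, h0, sub_zero, add_zero]

end LinearAlgebra

/-! ### The Larson–Radford theorem -/

section LarsonRadford

variable {K : Type u} {H : Type v} [Field K] [Ring H] [HopfAlgebra K H]

/-- The square of the antipode of `H`, if the latter is bijective, as an algebra automorphism. -/
noncomputable def antipodeSq (hS : Function.Bijective (antipode K : H →ₗ[K] H)) : H ≃ₐ[K] H :=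
  AlgEquiv.ofBijective
    (AlgHom.ofLinearMap (antipode K ∘ₗ antipode K : H →ₗ[K] H) (by simp [antipode_one])
      (fun x y => by simp [antipode_mul_antidistrib]))
    (hS.comp hS)

lemma antipodeSq_apply (hS : Function.Bijective (antipode K : H →ₗ[K] H)) (x : H) :
    antipodeSq hS x = antipode K (antipode K x) := rfl

lemma trace_antipodeSq (hS : Function.Bijective (antipode K : H →ₗ[K] H)) :
    LinearMap.trace K H (antipodeSq hS).toLinearMap =
      traceForm (antipode K ∘ₗ antipode K : H →ₗ[K] H) 1 := by
  rw [traceForm_apply, LinearMap.mulLeft_one]; rfl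

variable [FiniteDimensional K H]

/-- The linear form `x ↦ Tr (y ↦ x S²(y))` is a left integral of `H^*`. -/
lemma mul_traceForm_antipode (f : HopfDual K H) :
    f * traceForm (antipode K ∘ₗ antipode K : H →ₗ[K] H) =
      f 1 • traceForm (antipode K ∘ₗ antipode K : H →ₗ[K] H) := by
  refine mul_traceForm (ψ := antipode K) comul_antipode_antipode (fun x => ?_) (fun x => ?_)
  · have h : ∀ s : H ⊗[K] H, LinearMap.mul' K H (TensorProduct.map (antipode K ∘ₗ antipode K)
        (antipode K) (TensorProduct.comm K H H s)) =
        antipode K (LinearMap.mul' K H ((antipode K (A := H)).lTensor H s)) := by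
      intro s
      induction s with
      | zero => simp
      | add a b ha hb => simp only [map_add, ha, hb]
      | tmul a b => simp [antipode_mul_antidistrib]
    rw [h, mul_antipode_lTensor_comul_apply, Algebra.algebraMap_eq_smul_one, map_smul, antipode_one]
  · rw [mul_antipode_lTensor_comul_apply, Algebra.algebraMap_eq_smul_one, map_smul, smul_eq_mul]

/-- The operator `y ↦ t S²(y) = ε(y) t` has rank one, so its trace is `ε(t)`. -/
lemma traceForm_antipode_integral {t : H} (ht : IsIntegralElem K t)
    (ht1 : counit (R := K) t = 1) :
    traceForm (antipode K ∘ₗ antipode K : H →ₗ[K] H) t = 1 := by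
  have : LinearMap.mulLeft K t ∘ₗ (antipode K ∘ₗ antipode K : H →ₗ[K] H) =
      (counit (R := K) (A := H)).smulRight t := by
    ext x
    simp [ht.right]
  rw [traceForm_apply, this, LinearMap.trace_smulRight, ht1]

variable [IsAlgClosed K] [CharZero K] [IsSemisimpleRing H]

/-- `S²` fixes the centre, has finite order, and its composition with the multiplication by the
central element `t` is an operator of rank one and trace `1`. -/
lemma trace_antipodeSq_ne_zero (hS : Function.Bijective (antipode K : H →ₗ[K] H)) :
    LinearMap.trace K H (antipodeSq hS).toLinearMap ≠ 0 := by
  obtain ⟨t, ht, ht1⟩ := exists_integral (K := K) (H := H)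
  have hμ := mul_traceForm_antipode (K := K) (H := H)
  have hμt := traceForm_antipode_integral ht ht1
  obtain ⟨m, hm, hSm⟩ := exists_antipode_iterate_eq_id ht hμ hμt
  have hit : ∀ (n : ℕ) x, (antipodeSq hS)^[n] x = (antipode K : H →ₗ[K] H)^[2 * n] x := by
    intro n
    induction n with
    | zero => simp
    | succ n ih =>
      intro x
      rw [Function.iterate_succ_apply', ih, Nat.mul_succ, Nat.add_comm,
        Function.iterate_add_apply]
      rfl
  refine trace_ne_zero_of_central (antipodeSq hS)
    (fun z hz => antipode_antipode_of_central ht hμ hμt hz) (N := 2 * m) (by omega)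
    (fun x => ?_) (t := t) (fun x => by rw [ht.left, ht.right]) ?_
  · rw [hit, ← mul_assoc]; exact hSm x
  · have : (antipodeSq hS).toLinearMap ∘ₗ LinearMap.mulLeft K t =
        (counit (R := K) (A := H)).smulRight (antipode K (antipode K t)) := by
      ext x
      simp [ht.right, antipodeSq_apply]
    rw [this, LinearMap.trace_smulRight, counit_antipode, counit_antipode, ht1]
    exact one_ne_zero

/-- The **Larson–Radford theorem**: a semisimple Hopf algebra over an algebraically closed field of
characteristic zero is cosemisimple, and its antipode is an involution. -/
theorem larson_radford :
    IsSemisimpleRing (HopfDual K H) ∧ ∀ x : H, antipode K (antipode K x) = x := by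
  obtain ⟨t, ht, ht1⟩ := exists_integral (K := K) (H := H)
  set μ := traceForm (antipode K ∘ₗ antipode K : H →ₗ[K] H) with hμdef
  have hμ : ∀ f : HopfDual K H, f * μ = f 1 • μ := mul_traceForm_antipode (K := K) (H := H)
  have hμt : μ t = 1 := traceForm_antipode_integral ht ht1
  have hS := antipode_bijective ht hμ hμt
  have htr := trace_antipodeSq_ne_zero hS
  have hμ1 : μ 1 ≠ 0 := by rwa [trace_antipodeSq] at htr
  have hS' := antipode_dual_surjective hS.1
  have hss : IsSemisimpleRing (HopfDual K H) := isSemisimpleRing_of_integral hμ hS' hμ1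
  refine ⟨hss, ?_⟩
  obtain ⟨ν, hν, hν1⟩ := exists_integral (K := K) (H := HopfDual K H)
  have hμν : μ = counit (R := K) μ • ν := hν.eq_smul hν1 hμ
  -- `H^*` is unimodular, so that `μ` is also a right integral and the distinguished element is `1`
  have hμr : ∀ f : HopfDual K H, μ * f = f 1 • μ := fun f => by
    rw [hμν, smul_mul_assoc, hν.right, smul_comm]; rfl
  have hg : contractLeft (HopfDual.toDual K H μ) (comul t) = 1 := by
    refine eq_of_dual (K := K) fun f => ?_
    rw [← mul_apply_eq_contractLeft, hμr, map_smul, LinearMap.smul_apply, hμt, smul_eq_mul, mul_one]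
  have hS4 : ∀ x : H, antipode K (antipode K (antipode K (antipode K x))) = x := fun x => by
    have := mul_distinguished ht hμ hμt x
    rw [hg, mul_one, one_mul] at this
    exact this.symm
  have hSd : Function.Bijective (antipode K : HopfDual K H →ₗ[K] HopfDual K H) :=
    ⟨LinearMap.injective_iff_surjective.2 hS', hS'⟩
  -- `n⁻¹ ℓ` is an idempotent, so that multiplication by it is a projection
  set n : K := (Module.finrank K H : K) with hn
  have hfin : Module.finrank K (HopfDual K H) = Module.finrank K H := by
    rw [(HopfDual.toDual K H).finrank_eq, Subspace.dual_finrank_eq]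
  have hn0 : n ≠ 0 := by
    have : Nontrivial H := ⟨t, 0, fun h => by rw [h, map_zero] at ht1; exact zero_ne_one ht1⟩
    rw [hn]
    exact_mod_cast (Module.finrank_pos (R := K) (M := H)).ne'
  have hell : ell K H * ell K H = n • ell K H := by
    apply (bidualEquiv K H).injective
    rw [← bidualEquiv_mul, map_smul, bidualEquiv_ell, lam_mul_lam hSd, hfin]
  have hSell : antipode K (antipode K (ell K H)) = ell K H := by
    refine eq_of_dual (K := K) fun f => ?_
    rw [← antipode_dual_apply, ← antipode_dual_apply, apply_ell, apply_ell]
    exact regularCharacter_algEquiv (antipodeSq hSd) f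
  have hμell : μ (ell K H) = μ 1 := by
    rw [apply_ell, lam_apply]
    have : LinearMap.mulLeft K μ = (counit (R := K) (A := HopfDual K H)).smulRight μ := by
      ext1 f
      exact hμr f
    rw [this, LinearMap.trace_smulRight]; rfl
  have key := eq_one_of_trace_eq (V := H) (σ := (antipodeSq hS).toLinearMap)
    (P := n⁻¹ • LinearMap.mulLeft K (ell K H)) (x := 1) (LinearMap.ext hS4) ?_ ?_ ?_ htr ?_
    (map_one (antipodeSq hS))
  · exact fun x => LinearMap.congr_fun key x
  · ext x
    simp [← mul_assoc, hell, smul_smul, hn0]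
  · ext x
    simp only [Module.End.mul_apply, LinearMap.smul_apply, LinearMap.mulLeft_apply,
      AlgEquiv.toLinearMap_apply, map_smul, map_mul]
    rw [antipodeSq_apply hS (ell K H), hSell]
  · rw [smul_mul_assoc, map_smul, smul_eq_mul, ← mul_assoc, ← hn, mul_inv_cancel₀ hn0, one_mul,
      trace_antipodeSq, ← hμdef, ← hμell]
    rfl
  · intro h
    rw [← one_mul t, h, zero_mul, map_zero] at ht1
    exact zero_ne_one ht1

end LarsonRadford

/-! ### Regular characters as integrals -/

section NormalizedIntegral

variable {K : Type u} {H : Type v} [Field K] [Ring H] [HopfAlgebra K H]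

lemma finrank_hopfDual : Module.finrank K (HopfDual K H) = Module.finrank K H := by
  rw [(HopfDual.toDual K H).finrank_eq, Subspace.dual_finrank_eq]

lemma IsNormalizedIntegral.eq [IsSemisimpleRing H] {x y : H} (hx : IsNormalizedIntegral K H x)
    (hy : IsNormalizedIntegral K H y) : x = y := by
  obtain ⟨t, ht, ht1⟩ := exists_integral (K := K) (H := H)
  rw [ht.eq_smul ht1 hx.1, ht.eq_smul ht1 hy.1, hx.2, hy.2]

variable [FiniteDimensional K H]

/-- If the antipode is an involution, then the regular character is a left integral of `H^*`. -/
lemma mul_lam (hS : ∀ x : H, antipode K (antipode K x) = x) (f : HopfDual K H) :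
    f * lam K H = f 1 • lam K H := by
  have h := mul_traceForm_antipode f
  rwa [show (antipode K ∘ₗ antipode K : H →ₗ[K] H) = LinearMap.id from LinearMap.ext hS] at h

lemma isNormalizedIntegral_lam (hS : ∀ x : H, antipode K (antipode K x) = x) :
    IsNormalizedIntegral K (HopfDual K H) (lam K H) :=
  ⟨mul_lam hS, by rw [finrank_hopfDual]; exact lam_one⟩

lemma isNormalizedIntegral_ell (hS : ∀ x : H, antipode K (antipode K x) = x) :
    IsNormalizedIntegral K H (ell K H) := by
  have hS' : ∀ f : HopfDual K H, antipode K (antipode K f) = f := fun f =>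
    HopfDual.ext fun x => by rw [antipode_dual_apply, antipode_dual_apply, hS]
  refine ⟨fun y => ?_, ?_⟩
  · apply (bidualEquiv K H).injective
    rw [← bidualEquiv_mul, map_smul, bidualEquiv_ell, mul_lam hS']
    rfl
  · change (1 : HopfDual K H) (ell K H) = _
    rw [apply_ell, lam_one, finrank_hopfDual]

end NormalizedIntegral

/-! ### Simple modules of a semisimple algebra -/

section Decomposition

variable (A : Type v) [Ring A]

lemma exists_linearEquiv_pi_simple [IsSemisimpleRing A] :
    ∃ (r : ℕ) (N : Fin r → Submodule A A), Nonempty (A ≃ₗ[A] ∀ i, N i) ∧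
      ∀ i, IsSimpleModule A (N i) := by
  obtain ⟨r, N, e, hN⟩ := IsSemisimpleModule.exists_linearEquiv_fin_dfinsupp A A
  exact ⟨r, N, ⟨e.trans DFinsupp.linearEquivFunOnFintype⟩, hN⟩

variable {A}

/-- Every simple module occurs in a decomposition of the regular module into simple ones. -/
lemma exists_linearEquiv_of_isSimpleModule {r : ℕ} {N : Fin r → Submodule A A}
    (e : A ≃ₗ[A] ∀ i, N i) (hN : ∀ i, IsSimpleModule A (N i)) (W : Type w) [AddCommGroup W]
    [Module A W] [IsSimpleModule A W] : ∃ i, Nonempty (N i ≃ₗ[A] W) := by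
  have := IsSimpleModule.nontrivial A W
  obtain ⟨x, hx⟩ := exists_ne (0 : W)
  let g : (∀ i, N i) →ₗ[A] W := LinearMap.toSpanSingleton A W x ∘ₗ e.symm.toLinearMap
  have hg : g ≠ 0 := fun h => hx <| by
    have := LinearMap.congr_fun h (e 1)
    simpa [g] using this
  by_contra! hcon
  refine hg (LinearMap.pi_ext' fun i => ?_)
  rcases LinearMap.bijective_or_eq_zero (g ∘ₗ LinearMap.single A (fun i => N i) i) with h | h
  · exact ((hcon i).false (LinearEquiv.ofBijective _ h)).elim
  · rw [h, LinearMap.zero_comp]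

lemma finite_of_isSimpleModule {K : Type u} [Field K] [Algebra K A] [FiniteDimensional K A]
    (W : Type w) [AddCommGroup W] [Module K W] [Module A W] [IsScalarTower K A W]
    [IsSimpleModule A W] : FiniteDimensional K W :=
  Module.Finite.trans A W

lemma finrank_eq_of_linearEquiv {K : Type u} [Field K] [Algebra K A]
    {W W' : Type*} [AddCommGroup W] [Module K W] [Module A W] [IsScalarTower K A W]
    [AddCommGroup W'] [Module K W'] [Module A W'] [IsScalarTower K A W'] (e : W ≃ₗ[A] W') :
    Module.finrank K W = Module.finrank K W' :=
  (e.restrictScalars K).finrank_eq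

end Decomposition

/-! ### The Casimir element on simple modules -/

section SimpleModules

variable {K : Type u} {A : Type v} [Field K] [Ring A] [HopfAlgebra K A]
variable {W : Type w} [AddCommGroup W] [Module K W] [Module A W] [IsScalarTower K A W]

lemma trace_casimirMap (B : Module.End K W) (s : A ⊗[K] A) :
    LinearMap.trace K W (casimirMap B s) =
      LinearMap.trace K W (B * Algebra.lsmul K K W (LinearMap.mul' K A
        ((antipode K (A := A)).rTensor A (TensorProduct.comm K A A s)))) := by
  induction s with
  | zero => simp
  | add a b ha hb => simp only [map_add, mul_add, ha, hb]
  | tmul a b =>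
    rw [casimirMap_tmul, TensorProduct.comm_tmul, LinearMap.rTensor_tmul, LinearMap.mul'_apply,
      map_mul (Algebra.lsmul K K W), mul_assoc, LinearMap.trace_mul_comm, mul_assoc]

/-- `S(t₂) t₁ = ε(t)` if the antipode is an involution. -/
lemma mul_antipode_comm (hS : ∀ x : A, antipode K (antipode K x) = x) (t : A) :
    LinearMap.mul' K A ((antipode K (A := A)).rTensor A (TensorProduct.comm K A A (comul t))) =
      counit (R := K) t • 1 := by
  have h : ∀ s : A ⊗[K] A,
      LinearMap.mul' K A ((antipode K (A := A)).rTensor A (TensorProduct.comm K A A s)) =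
      antipode K (LinearMap.mul' K A ((antipode K (A := A)).rTensor A s)) := by
    intro s
    induction s with
    | zero => simp
    | add a b ha hb => simp only [map_add, ha, hb]
    | tmul a b => simp [antipode_mul_antidistrib, hS]
  rw [h, mul_antipode_rTensor_comul_apply, Algebra.algebraMap_eq_smul_one, map_smul, antipode_one]

/-- The map `a ⊗ b ↦ Tr(ρ(a) X) ρ(S(b))`. -/
noncomputable def casimirTrace (X : Module.End K W) : A ⊗[K] A →ₗ[K] Module.End K W :=
  TensorProduct.lift (LinearMap.mk₂ K
    (fun a b => LinearMap.trace K W (Algebra.lsmul K K W a * X) •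
      (Algebra.lsmul K K W (antipode K b) : Module.End K W))
    (fun a a' b => by simp [add_mul, add_smul]) (fun c a b => by simp [mul_smul])
    (fun a b b' => by simp) (fun c a b => by simp [smul_comm c]))

lemma casimirTrace_tmul (X : Module.End K W) (a b : A) :
    casimirTrace X (a ⊗ₜ[K] b) = LinearMap.trace K W (Algebra.lsmul K K W a * X) •
      (Algebra.lsmul K K W (antipode K b) : Module.End K W) := rfl

variable {ι : Type*} [Fintype ι]

/-- The element `∑ a₁ ⋯ aₘ S(b₁) ⋯ S(bₘ)`, for `m` copies of the sum `∑ aᵢ ⊗ bᵢ`. -/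
noncomputable def casimirWord (a b : ι → A) (m : ℕ) : A :=
  ∑ f : Fin m → ι, (List.ofFn fun k => a (f k)).prod *
    (List.ofFn fun k => antipode K (b (f k))).prod

lemma sum_fun_succ {M : Type*} [AddCommMonoid M] {m : ℕ} (F : (Fin (m + 1) → ι) → M) :
    ∑ f, F f = ∑ i, ∑ f : Fin m → ι, F (Fin.cons i f) := by
  rw [← (Fin.consEquiv fun _ => ι).sum_comp, Fintype.sum_prod_type]
  rfl

variable [FiniteDimensional K A] {a b : ι → A}

lemma cOne_eq_casimirWord (hab : comul (R := K) (ell K A) = ∑ i, a i ⊗ₜ b i) :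
    cOne K A = casimirWord (K := K) a b 2 := by
  rw [cOne, hab]
  simp only [casimirWord, sum_fun_succ, map_sum, LinearMap.lTensor_tmul, Finset.sum_mul_sum,
    Algebra.TensorProduct.tmul_mul_tmul, LinearMap.mul'_apply, Fin.cons_zero, Fin.cons_succ,
    List.ofFn_succ, List.ofFn_zero, List.prod_cons, List.prod_nil, mul_one, Finset.univ_unique,
    Finset.sum_singleton]

/-- A finite family representing the comultiplication of `ℓ`. -/
lemma exists_comul_ell_eq_sum : ∃ (s : Finset (A × A)) (a b : s → A),
    comul (R := K) (ell K A) = ∑ i, a i ⊗ₜ b i := by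
  refine ⟨(ℛ K (ell K A)).index, fun i => (ℛ K (ell K A)).left i,
    fun i => (ℛ K (ell K A)).right i, ?_⟩
  rw [← (ℛ K (ell K A)).eq]
  exact (Finset.sum_coe_sort (ℛ K (ell K A)).index
    fun i => (ℛ K (ell K A)).left i ⊗ₜ[K] (ℛ K (ell K A)).right i).symm

variable [IsAlgClosed K] [CharZero K]

/-- On a simple module `W`, the Casimir element `ℓ₁ ⊗ S(ℓ₂)` sends an endomorphism `B` to the
scalar `(dim A / dim W) Tr(B)`. -/
lemma casimirMap_ell [IsSimpleModule A W] (hS : ∀ x : A, antipode K (antipode K x) = x)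
    (B : Module.End K W) :
    casimirMap B (comul (R := K) (ell K A)) =
      ((Module.finrank K A : K) / Module.finrank K W * LinearMap.trace K W B) • 1 := by
  have := finite_of_isSimpleModule (K := K) (A := A) W
  have := IsSimpleModule.nontrivial A W
  have hell := isNormalizedIntegral_ell hS
  have hd : (Module.finrank K W : K) ≠ 0 :=
    Nat.cast_ne_zero.2 (Module.finrank_pos (R := K) (M := W)).ne'
  let q : Module.End A W :=
    { toFun := casimirMap B (comul (R := K) (ell K A))
      map_add' := map_add _
      map_smul' := casimirMap_comul_smul hell.1 (fun x => ⟨_, hS x⟩) B }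
  obtain ⟨c, hc⟩ :=
    (IsSimpleModule.algebraMap_end_bijective_of_isAlgClosed (A := A) (V := W) K).2 q
  have hq : casimirMap B (comul (R := K) (ell K A)) = c • 1 := by
    ext x
    change q x = _
    rw [← hc]; rfl
  have htr := trace_casimirMap B (comul (R := K) (ell K A))
  rw [mul_antipode_comm hS, hell.2, map_smul, map_one, mul_smul_comm, mul_one, hq, map_smul,
    map_smul, LinearMap.trace_one, smul_eq_mul, smul_eq_mul] at htr
  rw [hq]
  congr 1
  field_simp
  exact htr

/-- On a simple module `W`, the map `X ↦ Tr(ρ(ℓ₁) X) ρ(S(ℓ₂))` is multiplication by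
`dim A / dim W`: this is `casimirMap_ell` for endomorphisms of rank one, read in coordinates. -/
lemma casimirTrace_ell [IsSimpleModule A W] (hS : ∀ x : A, antipode K (antipode K x) = x)
    (X : Module.End K W) :
    casimirTrace X (comul (R := K) (ell K A)) =
      ((Module.finrank K A : K) / Module.finrank K W) • X := by
  have := finite_of_isSimpleModule (K := K) (A := A) W
  let β := Module.finBasis K W
  ext x
  rw [← sub_eq_zero, ← Module.forall_dual_apply_eq_zero_iff K]
  intro φ
  rw [map_sub, sub_eq_zero]
  have h : ∀ s : A ⊗[K] A, φ (casimirTrace X s x) =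
      ∑ j, β.coord j (casimirMap (φ.smulRight (X (β j)) : Module.End K W) s x) := by
    intro s
    induction s with
    | zero => simp
    | add a b ha hb => simp only [map_add, LinearMap.add_apply, ha, hb, Finset.sum_add_distrib]
    | tmul a b =>
      rw [casimirTrace_tmul, LinearMap.trace_eq_matrix_trace K β, Matrix.trace]
      simp only [casimirMap_tmul_apply, LinearMap.smul_apply, map_smul, Matrix.diag_apply,
        LinearMap.toMatrix_apply, smul_eq_mul, Finset.sum_mul]
      refine Finset.sum_congr rfl fun j _ => ?_
      simp only [LinearMap.smulRight_apply, smul_comm a, map_smul, smul_eq_mul]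
      rw [mul_comm]
      rfl
  rw [h]
  simp only [casimirMap_ell hS, LinearMap.trace_smulRight, LinearMap.smul_apply,
    Module.End.one_apply, map_smul, smul_eq_mul]
  conv_rhs => rw [← β.sum_repr x]
  simp only [map_sum, map_smul, smul_eq_mul, Finset.mul_sum]
  refine Finset.sum_congr rfl fun j _ => ?_
  rw [Module.Basis.coord_apply]
  ring

/-- On a simple module `W`, the words `casimirWord a b m` with `∑ aᵢ ⊗ bᵢ = Δ(ℓ)` for even `m` act
by powers of `dim A / dim W`: summing over the first letter contributes one factor through
`casimirMap_ell`, and then summing over the second letter one through `casimirTrace_ell`. -/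
lemma casimirWord_add_two_smul [IsSimpleModule A W]
    (hS : ∀ x : A, antipode K (antipode K x) = x)
    (hab : comul (R := K) (ell K A) = ∑ i, a i ⊗ₜ b i) (m : ℕ) :
    Algebra.lsmul K K W (casimirWord (K := K) a b (m + 2)) =
      ((Module.finrank K A : K) / Module.finrank K W) ^ 2 •
        Algebra.lsmul K K W (casimirWord (K := K) a b m) := by
  set q : K := (Module.finrank K A : K) / Module.finrank K W
  have h1 : ∀ B : Module.End K W, ∑ i, Algebra.lsmul K K W (a i) * B *
      Algebra.lsmul K K W (antipode K (b i)) = (q * LinearMap.trace K W B) • 1 := fun B => by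
    rw [← casimirMap_ell hS, hab, map_sum]
    rfl
  have h2 : ∀ X : Module.End K W, ∑ i, LinearMap.trace K W (Algebra.lsmul K K W (a i) * X) •
      (Algebra.lsmul K K W (antipode K (b i)) : Module.End K W) = q • X := fun X => by
    rw [← casimirTrace_ell hS, hab, map_sum]
    rfl
  simp only [casimirWord, sum_fun_succ, map_sum, Fin.cons_zero, Fin.cons_succ, List.ofFn_succ,
    List.prod_cons, Finset.smul_sum]
  rw [Finset.sum_comm]
  simp only [Finset.sum_comm (s := (Finset.univ : Finset ι))
    (t := (Finset.univ : Finset (Fin m → ι)))]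
  refine Finset.sum_congr rfl fun f _ => ?_
  generalize (List.ofFn fun k => a (f k)).prod = X
  generalize (List.ofFn fun k => antipode K (b (f k))).prod = Y
  calc _ = ∑ j, (∑ i, Algebra.lsmul K K W (a i) * Algebra.lsmul K K W (a j * X) *
        Algebra.lsmul K K W (antipode K (b i))) *
          (Algebra.lsmul K K W (antipode K (b j)) * Algebra.lsmul K K W Y) := by
        simp only [Finset.sum_mul, map_mul, mul_assoc]
    _ = q • (∑ j, LinearMap.trace K W (Algebra.lsmul K K W (a j) * Algebra.lsmul K K W X) •
        (Algebra.lsmul K K W (antipode K (b j)) : Module.End K W)) * Algebra.lsmul K K W Y := by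
        simp only [h1, Finset.smul_sum, Finset.sum_mul, smul_mul_assoc, one_mul, mul_smul,
          map_mul (Algebra.lsmul K K W)]
    _ = _ := by
        rw [h2, smul_smul, smul_mul_assoc, map_mul, sq]

lemma casimirWord_two_mul_smul [IsSimpleModule A W]
    (hS : ∀ x : A, antipode K (antipode K x) = x)
    (hab : comul (R := K) (ell K A) = ∑ i, a i ⊗ₜ b i) (k : ℕ) :
    Algebra.lsmul K K W (casimirWord (K := K) a b (2 * k)) =
      (((Module.finrank K A : K) / Module.finrank K W) ^ 2) ^ k • (1 : Module.End K W) := by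
  induction k with
  | zero => simp [casimirWord]
  | succ k ih => rw [Nat.mul_succ, casimirWord_add_two_smul hS hab, ih, smul_smul, ← pow_succ']

/-- The element `c = ℓ¹₁ ℓ²₁ S(ℓ¹₂) S(ℓ²₂)` acts on a simple module `W` by `(dim A / dim W)²`. -/
lemma lsmul_cOne [IsSimpleModule A W] (hS : ∀ x : A, antipode K (antipode K x) = x) :
    Algebra.lsmul K K W (cOne K A) =
      ((Module.finrank K A : K) / Module.finrank K W) ^ 2 • (1 : Module.End K W) := by
  obtain ⟨s, a, b, hab⟩ := exists_comul_ell_eq_sum (K := K) (A := A)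
  have h := casimirWord_two_mul_smul (W := W) hS hab 1
  rwa [mul_one, pow_one, ← cOne_eq_casimirWord hab] at h

end SimpleModules

/-! ### Elements and characters on the regular module -/

section RegularModule

variable {K : Type u} {A : Type v} [Field K] [Ring A] [Algebra K A]

/-- Elements of a semisimple algebra are determined by their actions on the simple summands of the
regular module. -/
lemma eq_of_lsmul_eq {r : ℕ} {N : Fin r → Submodule A A} (e : A ≃ₗ[A] ∀ i, N i) {x y : A}
    (h : ∀ i, Algebra.lsmul K K (N i) x = Algebra.lsmul K K (N i) y) : x = y := by
  rw [← mul_one x, ← mul_one y, ← smul_eq_mul, ← smul_eq_mul]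
  apply e.injective
  rw [map_smul, map_smul]
  ext1 i
  exact LinearMap.congr_fun (h i) (e 1 i)

variable [FiniteDimensional K A]

/-- The regular character is the sum of the traces on the summands of the regular module. -/
lemma regularCharacter_eq_sum {r : ℕ} {N : Fin r → Submodule A A} (e : A ≃ₗ[A] ∀ i, N i) (x : A) :
    regularCharacter K A x = ∑ i, LinearMap.trace K (N i) (Algebra.lsmul K K (N i) x) := by
  have : ∀ i, FiniteDimensional K (N i) := fun i =>
    inferInstanceAs (FiniteDimensional K ((N i).restrictScalars K))
  change LinearMap.trace K A (LinearMap.mulLeft K x) = _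
  rw [← LinearMap.trace_conj' (LinearMap.mulLeft K x) (e.restrictScalars K), trace_pi]
  refine Finset.sum_congr rfl fun i _ => ?_
  congr 1
  ext1 y
  have h : (e.restrictScalars K).conj (LinearMap.mulLeft K x) (Pi.single i y) =
      x • (Pi.single i y : ∀ i, N i) := by
    rw [LinearEquiv.conj_apply_apply]
    change e (x • e.symm _) = _
    rw [map_smul, e.apply_symm_apply]
  simp only [LinearMap.comp_apply, LinearMap.coe_single, h, LinearMap.proj_apply, Pi.smul_apply,
    Pi.single_eq_same, Algebra.lsmul_coe]

end RegularModule

/-! ### The formula for the Casimir element -/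

section Formula

variable {K : Type u} {H : Type v} [Field K] [IsAlgClosed K] [CharZero K] [Ring H]
  [HopfAlgebra K H] [FiniteDimensional K H] [IsSemisimpleRing H]

theorem cOneFormula : COneFormula K H := by
  have hS := (larson_radford (K := K) (H := H)).2
  intro ι _ _ W _ _ _ _ e hW hinj hsurj he
  obtain ⟨r, N, ⟨φ⟩, hN⟩ := exists_linearEquiv_pi_simple H
  refine eq_of_lsmul_eq (K := K) φ fun j => ?_
  have := hN j
  obtain ⟨i, ⟨ψ⟩⟩ := hsurj (N j) (hN j)
  rw [lsmul_cOne hS, finrank_eq_of_linearEquiv (K := K) ψ]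
  ext1 x
  have hx : ∀ k, e k • x = if k = i then x else 0 := fun k => by
    apply ψ.injective
    rw [map_smul, he]
    split_ifs <;> simp
  simp only [Algebra.lsmul_coe, Finset.sum_smul, smul_assoc, hx, smul_ite, smul_zero,
    Finset.sum_ite_eq', Finset.mem_univ, if_true]
  rfl

end Formula

/-! ### Integrality of power sums -/

section Arithmetic

/-- A rational number all of whose powers have a common denominator is an integer: its powers span a
finitely generated group, which it maps to itself. -/
lemma isIntegral_of_forall_mul_pow {c q : ℚ} (hc : c ≠ 0) (h : ∀ k : ℕ, ∃ z : ℤ, c * q ^ k = z) :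
    IsIntegral ℤ q := by
  let N : Submodule ℤ ℚ := Submodule.span ℤ (Set.range fun k : ℕ => c * q ^ k)
  have hfg : N.FG := by
    refine isNoetherian_submodule.1
      (isNoetherian_span_of_finite ℤ (Set.finite_singleton (1 : ℚ))) N ?_
    rw [Submodule.span_le]
    rintro _ ⟨k, rfl⟩
    obtain ⟨z, hz⟩ := h k
    change c * q ^ k ∈ _
    rw [hz]
    exact Submodule.mem_span_singleton.2 ⟨z, by simp⟩
  have hne : N ≠ ⊥ := fun hN => hc <| by
    have : c * q ^ 0 ∈ N := Submodule.subset_span ⟨0, rfl⟩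
    rw [hN, Submodule.mem_bot] at this
    simpa using this
  refine isIntegral_of_smul_mem_submodule N hne hfg q fun x hx => ?_
  induction hx using Submodule.span_induction with
  | mem x hx =>
    obtain ⟨k, rfl⟩ := hx
    refine Submodule.subset_span ⟨k + 1, ?_⟩
    simp only [smul_eq_mul]
    ring
  | zero => simp
  | add x y _ _ hx hy => rw [smul_add]; exact N.add_mem hx hy
  | smul a x _ hx => rw [smul_comm]; exact N.smul_mem a hx

/-- If all the power sums `∑ wⱼ qⱼᵏ` with positive weights are integers, then so are the `qⱼ`:
a suitable integral combination of shifted power sums isolates each of them. -/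
lemma isIntegral_of_forall_sum_mul_pow {ι : Type*} [Fintype ι] {w q : ι → ℚ} (hw : ∀ j, 0 < w j)
    (h : ∀ k : ℕ, ∃ z : ℤ, ∑ j, w j * q j ^ k = z) (i : ι) : IsIntegral ℤ (q i) := by
  classical
  let D : ℤ := ∏ j, ((q j).den : ℤ)
  have hD0 : (D : ℚ) ≠ 0 := by
    rw [Int.cast_ne_zero]
    exact Finset.prod_ne_zero_iff.2 fun j _ => by exact_mod_cast (q j).den_nz
  have hD : ∀ j, ∃ m : ℤ, (D : ℚ) * q j = m := fun j => by
    refine ⟨(∏ k ∈ Finset.univ.erase j, ((q k).den : ℤ)) * (q j).num, ?_⟩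
    have : D = (∏ k ∈ Finset.univ.erase j, ((q k).den : ℤ)) * (q j).den :=
      (Finset.prod_erase_mul _ _ (Finset.mem_univ j)).symm
    rw [this, Int.cast_mul, Int.cast_mul, mul_assoc]
    congr 1
    rw [mul_comm]
    exact_mod_cast Rat.mul_den_eq_num (q j)
  -- the factor `D (q j - r)` kills the terms with `q j = r`, and `D` clears the denominators
  have key : ∀ s : Finset ι, ∀ k : ℕ, ∃ z : ℤ,
      ∑ j, w j * (∏ r ∈ s.image q, (D * q j - D * r)) * q j ^ k = z := by
    intro s
    suffices ∀ t : Finset ℚ, t ⊆ Finset.univ.image q → ∀ k : ℕ, ∃ z : ℤ,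
        ∑ j, w j * (∏ r ∈ t, (D * q j - D * r)) * q j ^ k = z from
      this _ (Finset.image_subset_image (Finset.subset_univ s))
    intro t
    induction t using Finset.induction_on with
    | empty => simpa using h
    | insert r t hr ih =>
      intro ht k
      have ih' := ih ((Finset.subset_insert r t).trans ht)
      obtain ⟨z₁, h₁⟩ := ih' (k + 1)
      obtain ⟨z₂, h₂⟩ := ih' k
      obtain ⟨j₀, -, rfl⟩ := Finset.mem_image.1 (ht (Finset.mem_insert_self r t))
      obtain ⟨m, hm⟩ := hD j₀
      refine ⟨D * z₁ - m * z₂, ?_⟩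
      push_cast
      rw [← h₁, ← h₂, ← hm, Finset.mul_sum, Finset.mul_sum, ← Finset.sum_sub_distrib]
      refine Finset.sum_congr rfl fun j _ => ?_
      rw [Finset.prod_insert hr]
      ring
  let s := Finset.univ.filter fun j => q j ≠ q i
  have hP : ∏ r ∈ s.image q, ((D : ℚ) * q i - D * r) ≠ 0 := by
    refine Finset.prod_ne_zero_iff.2 fun r hr => ?_
    obtain ⟨j, hj, rfl⟩ := Finset.mem_image.1 hr
    rw [← mul_sub]
    exact mul_ne_zero hD0 (sub_ne_zero.2 (Finset.mem_filter.1 hj).2.symm)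
  have hW : ∑ j with q j = q i, w j ≠ 0 :=
    (Finset.sum_pos (fun j _ => hw j) ⟨i, by simp⟩).ne'
  refine isIntegral_of_forall_mul_pow (mul_ne_zero hW hP) fun k => ?_
  obtain ⟨z, hz⟩ := key s k
  refine ⟨z, ?_⟩
  rw [← hz, Finset.sum_mul, Finset.sum_mul, Finset.sum_filter]
  refine Finset.sum_congr rfl fun j _ => ?_
  split_ifs with hj
  · rw [hj]
  · have h0 : ∏ r ∈ s.image q, ((D : ℚ) * q j - D * r) = 0 :=
      Finset.prod_eq_zero (Finset.mem_image_of_mem q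
        (Finset.mem_filter.2 ⟨Finset.mem_univ j, hj⟩ : j ∈ s)) (sub_self _)
    rw [h0]
    simp

lemma dvd_of_forall_isIntegral {K : Type u} [Field K] [CharZero K] {ι : Type*} [Fintype ι]
    {d : ι → ℕ} (hd : ∀ j, 0 < d j) {n C : ℕ} (hC : 0 < C)
    (h : ∀ k : ℕ, IsIntegral ℤ ((C : K) * ∑ j, (((n : K) / d j) ^ 2) ^ k * d j)) (i : ι) :
    d i ∣ n := by
  have hint : IsIntegral ℤ (((n : ℚ) / d i) ^ 2) := by
    refine isIntegral_of_forall_sum_mul_pow (w := fun j => (C : ℚ) * d j)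
      (q := fun j => ((n : ℚ) / d j) ^ 2) (fun j => ?_) (fun k => ?_) i
    · have := hd j
      positivity
    · have h1 : IsIntegral ℤ (∑ j, (C : ℚ) * d j * (((n : ℚ) / d j) ^ 2) ^ k) := by
        rw [← isIntegral_algebraMap_iff (algebraMap ℚ K).injective]
        convert h k using 1
        rw [map_sum, Finset.mul_sum]
        refine Finset.sum_congr rfl fun j _ => ?_
        simp only [map_mul, map_pow, map_div₀, map_natCast]
        ring
      obtain ⟨z, hz⟩ := IsIntegrallyClosed.isIntegral_iff.1 h1
      exact ⟨z, hz.symm⟩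
  obtain ⟨z, hz⟩ := IsIntegrallyClosed.isIntegral_iff.1 (IsIntegral.of_pow two_pos hint)
  have hdi : (d i : ℚ) ≠ 0 := by exact_mod_cast (hd i).ne'
  rw [eq_div_iff hdi] at hz
  have : z * (d i : ℤ) = n := by
    have h2 : ((z * (d i : ℤ) : ℤ) : ℚ) = ((n : ℤ) : ℚ) := by
      push_cast
      exact hz
    exact_mod_cast h2
  exact_mod_cast Dvd.intro_left z this

end Arithmetic

/-! ### Divisibility of dimensions -/

section Divisibility

variable {K : Type u} {H : Type v} [Field K] [CharZero K] [Ring H]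
  [Algebra K H] [FiniteDimensional K H] [IsSemisimpleRing H]

/-- If elements `x k` act on all simple modules `W` by `(dim H / dim W) ^ (2 k)`, and the values of
the regular character at the `x k` are integral up to a common factor, then the dimensions of the
simple modules divide `dim H`. -/
lemma irrepDimsDvd_of_isIntegral {x : ℕ → H}
    (hx : ∀ (k : ℕ) (W : Submodule H H), IsSimpleModule H W → Algebra.lsmul K K W (x k) =
      (((Module.finrank K H : K) / Module.finrank K W) ^ 2) ^ k • (1 : Module.End K W))
    {C : ℕ} (hC : 0 < C) (h : ∀ k, IsIntegral ℤ ((C : K) * regularCharacter K H (x k))) :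
    IrrepDimsDvd.{u, v, w} K H (Module.finrank K H) := by
  intro W _ _ _ _ hW
  obtain ⟨r, N, ⟨φ⟩, hN⟩ := exists_linearEquiv_pi_simple H
  obtain ⟨i, ⟨ψ⟩⟩ := exists_linearEquiv_of_isSimpleModule φ hN W
  rw [← finrank_eq_of_linearEquiv (K := K) ψ]
  refine dvd_of_forall_isIntegral (K := K) (d := fun j => Module.finrank K (N j)) (fun j => ?_) hC
    (fun k => ?_) i
  · have := hN j
    have := finite_of_isSimpleModule (K := K) (A := H) (N j)
    have := IsSimpleModule.nontrivial H (N j)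
    exact Module.finrank_pos
  · convert h k using 2
    rw [regularCharacter_eq_sum φ]
    refine Finset.sum_congr rfl fun j _ => ?_
    rw [hx k _ (hN j), map_smul, LinearMap.trace_one, smul_eq_mul]

end Divisibility

section CentralCharacter

variable {K : Type u} {H : Type v} [Field K] [IsAlgClosed K] [CharZero K] [Ring H]
  [HopfAlgebra K H] [FiniteDimensional K H] [IsSemisimpleRing H]

/-- The case `x k = c ^ k` of `irrepDimsDvd_of_isIntegral`. -/
theorem irrepDimsDvd_of_lam_cOne (h : ∀ n : ℕ, ∃ z : ℤ, lam K H (cOne K H ^ n) = (z : K)) :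
    IrrepDimsDvd.{u, v, w} K H (Module.finrank K H) := by
  have hS := (larson_radford (K := K) (H := H)).2
  refine irrepDimsDvd_of_isIntegral (x := fun k => cOne K H ^ k) (fun k W hW => ?_) one_pos
    (fun k => ?_)
  · rw [map_pow, lsmul_cOne hS, smul_pow, one_pow]
  · obtain ⟨z, hz⟩ := h k
    rw [Nat.cast_one, one_mul]
    change IsIntegral ℤ (lam K H (cOne K H ^ k))
    rw [hz]
    exact isIntegral_algebraMap (R := ℤ) (A := K) (x := z)

end CentralCharacter

/-! ### Coproduct tensors -/

section Tensors

variable {K : Type u} {C : Type v} [Field K] [Ring C] [HopfAlgebra K C]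

lemma snocEquiv_tprod_tmul {n : ℕ} (g : Fin n → C) (y : C) :
    snocEquiv K C n (PiTensorProduct.tprod K g ⊗ₜ y) =
      PiTensorProduct.tprod K (Fin.snoc g y : Fin (n + 1) → C) := by
  rw [snocEquiv, LinearEquiv.trans_apply, TensorProduct.congr_tmul,
    PiTensorProduct.subsingletonEquiv_symm_apply']
  refine (TensorPower.tprod_mul_tprod K g fun _ : Fin 1 => y).trans ?_
  rw [Fin.append_right_eq_snoc]

/-- On pure tensors, comultiplication of the last factor, given a representation of the
comultiplication of that factor. -/
lemma comulLast_tprod_snoc {n : ℕ} {ι : Type*} [Fintype ι] {y : C} {a b : ι → C}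
    (h : comul (R := K) y = ∑ i, a i ⊗ₜ b i) (g : Fin n → C) :
    comulLast K C n (PiTensorProduct.tprod K (Fin.snoc g y : Fin (n + 1) → C)) =
      ∑ i, PiTensorProduct.tprod K
        (Fin.snoc (Fin.snoc g (a i) : Fin (n + 1) → C) (b i) : Fin (n + 2) → C) := by
  have hg := (LinearEquiv.symm_apply_eq _).2 (snocEquiv_tprod_tmul (K := K) g y).symm
  simp only [comulLast, LinearMap.comp_apply, LinearEquiv.coe_coe, hg,
    LinearMap.lTensor_tmul, h, TensorProduct.tmul_sum, map_sum, TensorProduct.assoc_symm_tmul,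
    LinearMap.rTensor_tmul, snocEquiv_tprod_tmul]

lemma tensorPairing_tprod {n : ℕ} (f : Fin n → HopfDual K C) (g : Fin n → C) :
    tensorPairing K C n (PiTensorProduct.tprod K f) (PiTensorProduct.tprod K g) =
      ∏ i, f i (g i) := by
  rw [tensorPairing, LinearMap.comp_apply, PiTensorProduct.map_tprod,
    PiTensorProduct.dualDistrib_apply]
  rfl

lemma ext_tprod_snoc {M : Type*} [AddCommGroup M] [Module K M] {n : ℕ}
    {φ ψ : (⨂[K]^(n + 1) C) →ₗ[K] M}
    (h : ∀ (g : Fin n → C) (y : C),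
      φ (PiTensorProduct.tprod K (Fin.snoc g y : Fin (n + 1) → C)) =
        ψ (PiTensorProduct.tprod K (Fin.snoc g y : Fin (n + 1) → C))) : φ = ψ := by
  refine PiTensorProduct.ext (MultilinearMap.ext fun g => ?_)
  have := h (Fin.init g) (g (Fin.last n))
  rw [Fin.snoc_init_self] at this
  exact this

/-- Comultiplying the last factor of a tensor in `(C^*)^{⊗ (n + 1)}` amounts, under the pairing, to
multiplying the last two factors in `C`. -/
lemma tensorPairing_comulLast [FiniteDimensional K C] {n : ℕ} (s : ⨂[K]^(n + 1) (HopfDual K C))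
    (g : Fin n → C) (x y : C) :
    tensorPairing K C (n + 2) (comulLast K (HopfDual K C) n s) (PiTensorProduct.tprod K
        (Fin.snoc (Fin.snoc g x : Fin (n + 1) → C) y : Fin (n + 2) → C)) =
      tensorPairing K C (n + 1) s (PiTensorProduct.tprod K
        (Fin.snoc g (x * y) : Fin (n + 1) → C)) := by
  have key : (LinearMap.applyₗ (PiTensorProduct.tprod K
        (Fin.snoc (Fin.snoc g x : Fin (n + 1) → C) y : Fin (n + 2) → C))) ∘ₗ
        tensorPairing K C (n + 2) ∘ₗ comulLast K (HopfDual K C) n =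
      (LinearMap.applyₗ (PiTensorProduct.tprod K (Fin.snoc g (x * y) : Fin (n + 1) → C))) ∘ₗ
        tensorPairing K C (n + 1) := by
    refine ext_tprod_snoc fun f φ => ?_
    have hφ : comul (R := K) φ = ∑ i : (ℛ K φ).index,
        (ℛ K φ).left i ⊗ₜ[K] (ℛ K φ).right i := by
      rw [Finset.sum_coe_sort (ℛ K φ).index fun i => (ℛ K φ).left i ⊗ₜ[K] (ℛ K φ).right i]
      exact (ℛ K φ).eq.symm
    have hxy : φ (x * y) = HopfDual.pairEquiv K C (comul φ) (x ⊗ₜ y) :=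
      (HopfDual.pairEquiv_comulMap φ (x ⊗ₜ y)).symm
    simp only [LinearMap.comp_apply, comulLast_tprod_snoc hφ, map_sum, LinearMap.applyₗ_apply_apply,
      tensorPairing_tprod, Fin.prod_univ_castSucc, Fin.snoc_castSucc, Fin.snoc_last, hxy]
    rw [hφ]
    simp only [map_sum, LinearMap.sum_apply, HopfDual.pairEquiv_tmul, Finset.mul_sum, mul_assoc]
  exact LinearMap.congr_fun key s

lemma tensorPairing_reindex {n : ℕ} (s : ⨂[K]^n (HopfDual K C)) (σ : Equiv.Perm (Fin n))
    (g : Fin n → C) :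
    tensorPairing K C n (PiTensorProduct.reindex K (fun _ => HopfDual K C) σ s)
      (PiTensorProduct.tprod K g) = tensorPairing K C n s (PiTensorProduct.tprod K (g ∘ σ)) := by
  have key : (LinearMap.applyₗ (PiTensorProduct.tprod K g)) ∘ₗ tensorPairing K C n ∘ₗ
        (PiTensorProduct.reindex K (fun _ => HopfDual K C) σ).toLinearMap =
      (LinearMap.applyₗ (PiTensorProduct.tprod K (g ∘ σ))) ∘ₗ tensorPairing K C n := by
    refine PiTensorProduct.ext (MultilinearMap.ext fun f => ?_)
    simp only [LinearMap.compMultilinearMap_apply, LinearMap.comp_apply, LinearEquiv.coe_coe,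
      LinearMap.applyₗ_apply_apply, PiTensorProduct.reindex_tprod, tensorPairing_tprod]
    exact (Fintype.prod_equiv σ _ _ fun i => by simp).symm
  exact LinearMap.congr_fun key s

lemma option_elim_comp_finSuccEquivLast {A B : Type*} {m : ℕ} (f : A → B) (z : B) (e : Fin m ≃ A) :
    (fun j : Option A => j.elim z f) ∘ finSuccEquivLast.trans (Equiv.optionCongr e) =
      (Fin.snoc (f ∘ e) z : Fin (m + 1) → B) := by
  funext i
  refine Fin.lastCases ?_ (fun i => ?_) i <;> simp

/-- The sum of the pure tensors of a finite family of functions `g φ : J → C`, in any ordering of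
the finite set `J`, is a coproduct tensor. -/
def IsCoproductFamily (K : Type u) {C : Type v} [Field K] [Ring C] [HopfAlgebra K C] (x : C)
    {Φ J : Type*} [Fintype Φ] (g : Φ → J → C) : Prop :=
  ∀ (n : ℕ) (e : Fin n ≃ J),
    IsCoproductTensor (K := K) x n (∑ φ, PiTensorProduct.tprod K (g φ ∘ e))

lemma IsCoproductFamily.congr {x : C} {Φ Φ' J J' : Type*} [Fintype Φ] [Fintype Φ']
    {g : Φ → J → C} (h : IsCoproductFamily K x g) {g' : Φ' → J' → C} (ε : Φ' ≃ Φ) (e : J' ≃ J)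
    (hg : ∀ φ j, g' φ j = g (ε φ) (e j)) : IsCoproductFamily K x g' := by
  intro n e'
  convert h n (e'.trans e) using 1
  rw [← ε.sum_comp]
  refine Finset.sum_congr rfl fun φ _ => congrArg _ (funext fun i => hg φ (e' i))

/-- It suffices to consider one ordering of the index set. -/
lemma isCoproductFamily_of_equiv {x : C} {Φ J : Type*} [Fintype Φ] {g : Φ → J → C} {n : ℕ}
    (e : Fin n ≃ J)
    (h : IsCoproductTensor (K := K) x n (∑ φ, PiTensorProduct.tprod K (g φ ∘ e))) :
    IsCoproductFamily K x g := by
  intro m e'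
  obtain rfl : n = m := by simpa using Fintype.card_congr (e.trans e'.symm)
  convert IsCoproductTensor.perm (e.trans e'.symm) h using 1
  simp only [map_sum]
  refine Finset.sum_congr rfl fun φ _ => ?_
  refine Eq.trans (congrArg _ ?_) (PiTensorProduct.reindex_tprod (R := K) (s := fun _ => C)
    (e.trans e'.symm) (g φ ∘ e)).symm
  funext i
  simp

lemma isCoproductFamily_const (x : C) (J : Type*) [Finite J] :
    IsCoproductFamily K x fun (_ : Unit) (_ : J) => x := by
  intro n e
  rw [Finset.univ_unique, Finset.sum_singleton]
  exact IsCoproductTensor.base n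

/-- Comultiplying one factor of a family of pure tensors. -/
lemma IsCoproductFamily.comul {x y : C} {Φ J ι : Type*} [Fintype Φ] [Finite J] [Fintype ι]
    {g : Φ → J → C} {a b : ι → C} (hy : comul (R := K) y = ∑ i, a i ⊗ₜ b i)
    (h : IsCoproductFamily K x fun φ (j : Option J) => j.elim y (g φ)) :
    IsCoproductFamily K x fun (φ : Φ × ι) (j : Option (Option J)) =>
      j.elim (b φ.2) fun j => j.elim (a φ.2) (g φ.1) := by
  obtain ⟨n, ⟨e⟩⟩ : ∃ n, Nonempty (Fin n ≃ J) := ⟨_, ⟨(Finite.equivFin J).symm⟩⟩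
  refine isCoproductFamily_of_equiv
    (finSuccEquivLast.trans (Equiv.optionCongr (finSuccEquivLast.trans (Equiv.optionCongr e))))
    ?_
  have h' := h (n + 1) (finSuccEquivLast.trans (Equiv.optionCongr e))
  convert IsCoproductTensor.comul h' using 1
  simp only [option_elim_comp_finSuccEquivLast, map_sum, comulLast_tprod_snoc hy,
    Fintype.sum_prod_type]

/-- Comultiplying the first `p` factors of `x^{⊗ (p + q)}`, for a representation `∑ aᵢ ⊗ bᵢ` of
`Δ(x)`. -/
lemma isCoproductFamily_comul_pow {x : C} {ι : Type*} [Fintype ι] {a b : ι → C}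
    (hx : comul (R := K) x = ∑ i, a i ⊗ₜ b i) (p q : ℕ) :
    IsCoproductFamily K x fun (f : Fin p → ι) (j : (Fin p ⊕ Fin p) ⊕ Fin q) =>
      j.elim (Sum.elim (a ∘ f) (b ∘ f)) fun _ => x := by
  induction p generalizing q with
  | zero =>
    exact (isCoproductFamily_const (K := K) x ((Fin 0 ⊕ Fin 0) ⊕ Fin q)).congr
      (Equiv.equivPUnit _) (Equiv.refl _) fun φ j => by
        rcases j with (j | j) | j
        · exact j.elim0
        · exact j.elim0
        · rfl
  | succ p ih =>
    have h := ih (q + 1)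
    -- single out one of the `q + 1` unsplit factors, to be comultiplied
    let e₁ : Option ((Fin p ⊕ Fin p) ⊕ Fin q) ≃ (Fin p ⊕ Fin p) ⊕ Fin (q + 1) :=
      (Equiv.optionEquivSumPUnit.{0} _).trans <| (Equiv.sumAssoc _ _ _).trans <|
        (Equiv.sumCongr (Equiv.refl _) ((Equiv.optionEquivSumPUnit.{0} _).symm.trans
          (finSuccEquiv q).symm))
    have h₁ := (h.congr (g' := fun f (j : Option ((Fin p ⊕ Fin p) ⊕ Fin q)) =>
        j.elim x fun j => j.elim (Sum.elim (a ∘ f) (b ∘ f)) fun _ => x) (Equiv.refl _) e₁ (by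
      rintro f (_ | ((j | j) | j)) <;> rfl)).comul hx
    -- the two new factors become the first ones in their groups
    let e₂ : (Fin (p + 1) ⊕ Fin (p + 1)) ⊕ Fin q ≃ Option (Option ((Fin p ⊕ Fin p) ⊕ Fin q)) :=
      { toFun := Sum.elim
          (Sum.elim (Fin.cons (some none) fun j => some (some (Sum.inl (Sum.inl j))))
            (Fin.cons none fun j => some (some (Sum.inl (Sum.inr j)))))
          (fun j => some (some (Sum.inr j)))
        invFun := fun o => o.elim (Sum.inl (Sum.inr 0)) fun o => o.elim (Sum.inl (Sum.inl 0)) <|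
          Sum.elim (Sum.elim (fun j => Sum.inl (Sum.inl j.succ)) fun j => Sum.inl (Sum.inr j.succ))
            Sum.inr
        left_inv := by
          rintro ((j | j) | j)
          · refine Fin.cases ?_ (fun j => ?_) j <;> rfl
          · refine Fin.cases ?_ (fun j => ?_) j <;> rfl
          · rfl
        right_inv := by rintro (_ | _ | ((j | j) | j)) <;> rfl }
    refine h₁.congr ((Fin.consEquiv fun _ => ι).symm.trans (Equiv.prodComm _ _)) e₂ ?_
    rintro f ((j | j) | j)
    · refine Fin.cases ?_ (fun j => ?_) j <;> rfl
    · refine Fin.cases ?_ (fun j => ?_) j <;> rfl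
    · rfl

/-- The function `F` on `J`-tuples of elements of `C` is the evaluation of a coproduct tensor of
`f` in a tensor power of `C^*`, in any ordering of the finite set `J`. -/
def IsCoproductForm [FiniteDimensional K C] (f : HopfDual K C) {J : Type*} (F : (J → C) → K) :
    Prop :=
  ∀ (n : ℕ) (e : Fin n ≃ J), ∃ s, IsCoproductTensor (K := K) f n s ∧
    ∀ g : J → C, tensorPairing K C n s (PiTensorProduct.tprod K (g ∘ e)) = F g

variable [FiniteDimensional K C] {f : HopfDual K C}

lemma IsCoproductForm.congr {J J' : Type*} {F : (J → C) → K} (h : IsCoproductForm f F)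
    {F' : (J' → C) → K} (e : J ≃ J') (hF : ∀ g, F' g = F (g ∘ e)) : IsCoproductForm f F' := by
  intro n e'
  obtain ⟨s, hs, hsF⟩ := h n (e'.trans e.symm)
  refine ⟨s, hs, fun g => ?_⟩
  rw [hF, ← hsF]
  congr 2
  funext i
  simp

lemma isCoproductForm_of_equiv {J : Type*} {F : (J → C) → K} {n : ℕ} (e : Fin n ≃ J)
    {s : ⨂[K]^n (HopfDual K C)} (hs : IsCoproductTensor (K := K) f n s)
    (h : ∀ g : J → C, tensorPairing K C n s (PiTensorProduct.tprod K (g ∘ e)) = F g) :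
    IsCoproductForm f F := by
  intro m e'
  obtain rfl : n = m := by simpa using Fintype.card_congr (e.trans e'.symm)
  refine ⟨_, IsCoproductTensor.perm (e.trans e'.symm) hs, fun g => ?_⟩
  rw [tensorPairing_reindex, ← h]
  congr 2
  funext i
  simp

lemma isCoproductForm_prod (f : HopfDual K C) (J : Type*) [Fintype J] :
    IsCoproductForm f fun g : J → C => ∏ j, f (g j) := by
  intro n e
  refine ⟨_, IsCoproductTensor.base n, fun g => ?_⟩
  rw [tensorPairing_tprod]
  exact e.prod_comp fun j => f (g j)

/-- Comultiplying one factor of a coproduct form: it is replaced by two factors, whose product is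
inserted into the form. -/
lemma IsCoproductForm.comul {J : Type*} [Finite J] {F : (Option J → C) → K}
    (h : IsCoproductForm f F) : IsCoproductForm f fun g : Option (Option J) → C =>
      F fun j => j.elim (g (some none) * g none) fun j => g (some (some j)) := by
  obtain ⟨n, ⟨e⟩⟩ : ∃ n, Nonempty (Fin n ≃ J) := ⟨_, ⟨(Finite.equivFin J).symm⟩⟩
  obtain ⟨s, hs, hsF⟩ := h (n + 1) (finSuccEquivLast.trans (Equiv.optionCongr e))
  refine isCoproductForm_of_equiv
    (finSuccEquivLast.trans (Equiv.optionCongr (finSuccEquivLast.trans (Equiv.optionCongr e))))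
    hs.comul fun g => ?_
  rw [← hsF]
  convert tensorPairing_comulLast s (fun i => g (some (some (e i)))) (g (some none)) (g none)
    using 3
  · funext i
    refine Fin.lastCases ?_ (fun i => ?_) i
    · simp
    · refine Fin.lastCases ?_ (fun i => ?_) i <;> simp
  · funext i
    refine Fin.lastCases ?_ (fun i => ?_) i <;> simp

/-- Comultiplying one factor of a coproduct form repeatedly: a product of any positive length can
be inserted in place of the factor. -/
lemma IsCoproductForm.iterate {J : Type*} [Finite J] {F : (Option J → C) → K}
    (h : IsCoproductForm f F) (p : ℕ) : IsCoproductForm f fun g : J ⊕ Fin (p + 1) → C =>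
      F fun j => j.elim (List.ofFn fun i => g (Sum.inr i)).prod fun j => g (Sum.inl j) := by
  induction p with
  | zero =>
    refine h.congr ((Equiv.optionEquivSumPUnit.{0} J).trans
      (Equiv.sumCongr (Equiv.refl J) (Equiv.ofUnique PUnit (Fin 1)))) fun g => congrArg F ?_
    funext j
    rcases j with _ | j
    · simp
    · rfl
  | succ p ih =>
    have h₁ := (ih.congr (J' := Option (J ⊕ Fin p)) (F' := fun g => F fun j =>
      j.elim (g none * (List.ofFn fun i => g (some (Sum.inr i))).prod)
        fun j => g (some (Sum.inl j)))
      { toFun := Sum.elim (fun j => some (Sum.inl j)) (Fin.cons none fun i => some (Sum.inr i))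
        invFun := fun o => o.elim (Sum.inr 0) (Sum.map id Fin.succ)
        left_inv := by
          rintro (j | j)
          · rfl
          · refine Fin.cases ?_ (fun j => ?_) j <;> rfl
        right_inv := by rintro (_ | (j | j)) <;> rfl } fun g => congrArg F <| by
          funext j
          rcases j with _ | j
          · simp [List.ofFn_succ]
          · rfl).comul
    refine h₁.congr (J' := J ⊕ Fin (p + 2))
      { toFun := fun o => o.elim (Sum.inr 1) fun o => o.elim (Sum.inr 0) <|
          Sum.map id fun i => i.succ.succ
        invFun := Sum.elim (fun j => some (some (Sum.inl j)))
          (Fin.cons (some none) (Fin.cons none fun i => some (some (Sum.inr i))))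
        left_inv := by rintro (_ | (_ | (j | j))) <;> rfl
        right_inv := by
          rintro (j | j)
          · rfl
          · refine Fin.cases ?_ (fun j => ?_) j
            · rfl
            · refine Fin.cases ?_ (fun j => ?_) j <;> rfl } fun g => congrArg F ?_
    funext j
    rcases j with _ | j
    · simp [List.ofFn_succ, mul_assoc]
    · rfl

/-- The product of the values of `f` at two words is a coproduct form of `f`. -/
lemma isCoproductForm_mul (f : HopfDual K C) (p q : ℕ) :
    IsCoproductForm f fun g : Fin (p + 1) ⊕ Fin (q + 1) → C =>
      f (List.ofFn fun i => g (Sum.inl i)).prod * f (List.ofFn fun i => g (Sum.inr i)).prod := by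
  have h₁ := (isCoproductForm_prod f (Option Unit)).iterate p
  have h₂ := (h₁.congr (J' := Option (Fin (p + 1))) (F' := fun g =>
    f (List.ofFn fun i => g (some i)).prod * f (g none))
    { toFun := Sum.elim (fun _ => none) some
      invFun := fun o => o.elim (Sum.inl ()) Sum.inr
      left_inv := by rintro (_ | i) <;> rfl
      right_inv := by rintro (_ | i) <;> rfl } fun g => by
        simp [Fintype.prod_option]).iterate q
  exact h₂

end Tensors

/-! ### Words as basic invariants -/

section Words

variable {K : Type u} {H : Type v} [Field K] [Ring H] [HopfAlgebra K H]

lemma antipode_prod_ofFn {m : ℕ} (g : Fin m → H) :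
    antipode K (List.ofFn fun i => g i.rev).prod = (List.ofFn fun i => antipode K (g i)).prod := by
  induction m with
  | zero => simp
  | succ m ih =>
    rw [List.ofFn_succ, List.prod_cons, antipode_mul_antidistrib, List.ofFn_succ',
      List.concat_eq_append, List.prod_append, List.prod_singleton, Fin.rev_zero,
      ← ih fun i => g i.castSucc]
    simp only [Fin.rev_succ]

variable [FiniteDimensional K H]

variable {ι : Type*} [Fintype ι] {a b : ι → H}

/-- The first factors of the copies of `Δ(ℓ)` are paired with one copy of `λ`, the second factors in
reversed order with another one. -/
lemma isBasicInvariant_sum (hab : comul (R := K) (ell K H) = ∑ i, a i ⊗ₜ b i) (m : ℕ) :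
    IsBasicInvariant K H (∑ f : Fin (m + 1) → ι, lam K H (List.ofFn fun i => a (f i)).prod *
        lam K H (List.ofFn fun i => b (f i.rev)).prod) := by
  have h₁ := (isCoproductFamily_comul_pow hab (m + 1) 0).congr (J' := Fin (m + 1) ⊕ Fin (m + 1))
    (g' := fun f j => Sum.elim (a ∘ f) (b ∘ f) j) (Equiv.refl _) (Equiv.sumEmpty _ _).symm
    fun f j => rfl
  have h₂ := (isCoproductForm_mul (lam K H) m m).congr (J' := Fin (m + 1) ⊕ Fin (m + 1))
    (F' := fun g => lam K H (List.ofFn fun i => g (Sum.inl i)).prod *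
      lam K H (List.ofFn fun i => g (Sum.inr i.rev)).prod)
    (Equiv.sumCongr (Equiv.refl _) Fin.revPerm) fun g => rfl
  obtain ⟨s, hs, hsF⟩ := h₂ _ finSumFinEquiv.symm
  refine ⟨_, _, s, h₁ _ finSumFinEquiv.symm, hs, ?_⟩
  rw [map_sum]
  exact Finset.sum_congr rfl fun f _ => (hsF (Sum.elim (a ∘ f) (b ∘ f))).symm

variable [IsSemisimpleRing H]

/-- `ℓ₁ λ(ℓ₂ x) = (dim H) S(x)` -/
lemma contractRight_lam_mulRight (hS : ∀ x : H, antipode K (antipode K x) = x) (x : H) :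
    contractRight (HopfDual.toDual K H (lam K H) ∘ₗ LinearMap.mulRight K x)
      (comul (R := K) (ell K H)) = (Module.finrank K H : K) • antipode K x := by
  obtain ⟨t, ht, ht1⟩ := exists_integral (K := K) (H := H)
  have hell : ell K H = (Module.finrank K H : K) • t :=
    (ht.eq_smul ht1 (isNormalizedIntegral_ell hS).1).trans
      (congrArg (· • t) (isNormalizedIntegral_ell hS).2)
  have hlt : lam K H t = 1 := by
    have h : LinearMap.mulLeft K t = LinearMap.smulRight (counit (R := K) (A := H)) t :=
      LinearMap.ext ht.right
    rw [lam_apply, h, LinearMap.trace_smulRight, ht1]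
  have := contractRight_mulRight ht (mul_lam hS) hlt (antipode K x)
  rw [hS] at this
  rw [hell, map_smul, map_smul, this]

/-- Pairing `Δ(ℓ)^{⊗ (m + 1)}` with two iterated coproducts of `λ`, the second in reversed order. In
the sum over the last letter, the identity `ℓ₁ λ(ℓ₂ y) = (dim H) S(y)` turns the reversed word `y`
in the remaining letters into a word in their antipodes. -/
lemma sum_lam_mul_lam (hS : ∀ x : H, antipode K (antipode K x) = x)
    (hab : comul (R := K) (ell K H) = ∑ i, a i ⊗ₜ b i) (m : ℕ) :
    ∑ f : Fin (m + 1) → ι, lam K H (List.ofFn fun i => a (f i)).prod *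
        lam K H (List.ofFn fun i => b (f i.rev)).prod =
      (Module.finrank K H : K) * lam K H (casimirWord (K := K) a b m) := by
  have key : ∀ x y : H, ∑ i, lam K H (x * a i) * lam K H (b i * y) =
      (Module.finrank K H : K) * lam K H (x * antipode K y) := fun x y => by
    have h := congrArg (fun z => lam K H (x * z)) (contractRight_lam_mulRight hS y)
    simp only [hab, map_sum, contractRight_tmul, mul_smul_comm, map_smul, Finset.mul_sum] at h
    rw [← smul_eq_mul (_ : K), ← h]
    exact Finset.sum_congr rfl fun i _ => mul_comm _ _
  rw [← (Fin.snocEquiv fun _ => ι).sum_comp, Fintype.sum_prod_type_right, casimirWord, map_sum,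
    Finset.mul_sum]
  refine Finset.sum_congr rfl fun f _ => ?_
  rw [← antipode_prod_ofFn fun k => b (f k), ← key]
  refine Finset.sum_congr rfl fun i _ => ?_
  congr 2
  · simp [Fin.snocEquiv, List.ofFn_succ', List.concat_eq_append, -List.ofFn_succ]
  · simp [Fin.snocEquiv, List.ofFn_succ, Fin.rev_succ]

end Words

/-! ### Basic invariants of the dual -/

section Duality

variable {K : Type u} {C : Type v} {D : Type w} [Field K] [Ring C] [HopfAlgebra K C] [Ring D]
  [HopfAlgebra K D]

lemma map_comulLast {φ : C →ₗ[K] D}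
    (hφ : ∀ x, comul (R := K) (φ x) = TensorProduct.map φ φ (comul (R := K) x)) {n : ℕ}
    (t : ⨂[K]^(n + 1) C) :
    PiTensorProduct.map (fun _ => φ) (comulLast K C n t) =
      comulLast K D n (PiTensorProduct.map (fun _ => φ) t) := by
  have hsnoc : ∀ {m : ℕ} (g : Fin m → C) (y : C),
      (fun i => φ ((Fin.snoc g y : Fin (m + 1) → C) i)) = Fin.snoc (fun i => φ (g i)) (φ y) :=
    fun g y => Fin.comp_snoc φ g y
  have key : PiTensorProduct.map (fun _ => φ) ∘ₗ comulLast K C n =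
      comulLast K D n ∘ₗ PiTensorProduct.map (fun _ => φ) := by
    refine ext_tprod_snoc fun g y => ?_
    have hy : comul (R := K) y = ∑ i : (ℛ K y).index, (ℛ K y).left i ⊗ₜ[K] (ℛ K y).right i := by
      rw [Finset.sum_coe_sort (ℛ K y).index fun i => (ℛ K y).left i ⊗ₜ[K] (ℛ K y).right i]
      exact (ℛ K y).eq.symm
    have hy' : comul (R := K) (φ y) =
        ∑ i : (ℛ K y).index, φ ((ℛ K y).left i) ⊗ₜ[K] φ ((ℛ K y).right i) := by
      rw [hφ, hy, map_sum]
      rfl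
    simp only [LinearMap.comp_apply, comulLast_tprod_snoc hy, map_sum, PiTensorProduct.map_tprod,
      hsnoc, comulLast_tprod_snoc hy']
  exact LinearMap.congr_fun key t

/-- Coalgebra maps preserve coproduct tensors. -/
lemma IsCoproductTensor.map {φ : C →ₗ[K] D}
    (hφ : ∀ x, comul (R := K) (φ x) = TensorProduct.map φ φ (comul (R := K) x)) {x : C} {n : ℕ}
    {t : ⨂[K]^n C} (h : IsCoproductTensor (K := K) x n t) :
    IsCoproductTensor (K := K) (φ x) n (PiTensorProduct.map (fun _ => φ) t) := by
  induction h with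
  | base a =>
    rw [PiTensorProduct.map_tprod]
    exact .base a
  | comul _ ih =>
    rw [map_comulLast hφ]
    exact ih.comul
  | perm σ _ ih =>
    exact (PiTensorProduct.map_reindex (R := K) (s := fun _ => C) (t := fun _ => D) (fun _ => φ) σ
      _).symm ▸ ih.perm σ

variable [FiniteDimensional K C]

lemma comul_bidualEquiv (x : C) : comul (R := K) (bidualEquiv K C x) =
    TensorProduct.map (bidualEquiv K C).toLinearMap (bidualEquiv K C).toLinearMap
      (comul (R := K) x) := by
  apply (HopfDual.pairEquiv K (HopfDual K C)).injective
  ext f g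
  change HopfDual.pairEquiv K (HopfDual K C) (HopfDual.comulMap K (HopfDual K C)
    (bidualEquiv K C x)) (f ⊗ₜ g) = HopfDual.pairEquiv K (HopfDual K C) _ (f ⊗ₜ g)
  rw [HopfDual.pairEquiv_comulMap, LinearMap.mul'_apply, bidualEquiv_apply, HopfDual.mul_eq]
  induction (comul (R := K) x) with
  | zero => simp
  | add a b ha hb => simp only [map_add, LinearMap.add_apply, ha, hb]
  | tmul a b => rfl

lemma comul_bidualEquiv_symm (x : HopfDual K (HopfDual K C)) :
    comul (R := K) ((bidualEquiv K C).symm x) =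
      TensorProduct.map (bidualEquiv K C).symm.toLinearMap (bidualEquiv K C).symm.toLinearMap
        (comul (R := K) x) := by
  obtain ⟨y, rfl⟩ := (bidualEquiv K C).surjective x
  rw [LinearEquiv.symm_apply_apply, comul_bidualEquiv, ← LinearMap.comp_apply,
    ← TensorProduct.map_comp]
  simp

/-- Under `H = H^{**}`, the regular character of the bidual is `λ`. -/
lemma ell_hopfDual : ell K (HopfDual K C) = lam K C := by
  ext x
  have h : LinearMap.mulLeft K (bidualEquiv K C x) =
      (bidualEquiv K C).conj (LinearMap.mulLeft K x) := by
    refine LinearMap.ext fun y => ?_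
    obtain ⟨y, rfl⟩ := (bidualEquiv K C).surjective y
    simp [LinearEquiv.conj_apply, bidualEquiv_mul]
  rw [← bidualEquiv_apply, apply_ell, lam_apply, lam_apply, h, LinearMap.trace_conj']

/-- A basic invariant of the dual is a basic invariant. -/
lemma isBasicInvariant_of_hopfDual {a : K} (h : IsBasicInvariant K (HopfDual K C) a) :
    IsBasicInvariant K C a := by
  obtain ⟨n, t, s, ht, hs, rfl⟩ := h
  have hs' := IsCoproductTensor.map (φ := (bidualEquiv K C).symm.toLinearMap)
    comul_bidualEquiv_symm hs
  rw [LinearEquiv.coe_coe, ← bidualEquiv_ell, LinearEquiv.symm_apply_apply] at hs'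
  rw [ell_hopfDual] at ht
  refine ⟨n, _, t, hs', ht, ?_⟩
  have key : tensorPairing K (HopfDual K C) n = (tensorPairing K C n).flip ∘ₗ
      PiTensorProduct.map fun _ => (bidualEquiv K C).symm.toLinearMap := by
    refine PiTensorProduct.ext (MultilinearMap.ext fun f => ?_)
    refine PiTensorProduct.ext (MultilinearMap.ext fun g => ?_)
    simp only [LinearMap.compMultilinearMap_apply, LinearMap.comp_apply, LinearMap.flip_apply,
      PiTensorProduct.map_tprod, tensorPairing_tprod, LinearEquiv.coe_coe]
    refine Finset.prod_congr rfl fun i _ => ?_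
    exact congrArg (fun F : HopfDual K (HopfDual K C) => F (g i))
      ((bidualEquiv K C).apply_symm_apply (f i)).symm
  rw [key]
  rfl

end Duality

/-! ### Divisibility from basic invariants -/

section Kaplansky

variable {K : Type u} {H : Type v} [Field K] [IsAlgClosed K] [CharZero K] [Ring H]
  [HopfAlgebra K H] [FiniteDimensional K H] [IsSemisimpleRing H]

/-- The basic invariants `(dim H) λ(x k)`, for the words `x k` in `2 k` copies of `Δ(ℓ)`, are of the
form required by `irrepDimsDvd_of_isIntegral`. -/
theorem irrepDimsDvd_of_isBasicInvariant
    (h : ∀ a : K, IsBasicInvariant K H a → IsIntegral ℤ a) :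
    IrrepDimsDvd.{u, v, w} K H (Module.finrank K H) := by
  have hS := (larson_radford (K := K) (H := H)).2
  obtain ⟨s, a, b, hab⟩ := exists_comul_ell_eq_sum (K := K) (A := H)
  refine irrepDimsDvd_of_isIntegral (K := K) (x := fun k => casimirWord (K := K) a b (2 * k))
    (C := Module.finrank K H) (fun k W hW => casimirWord_two_mul_smul hS hab k) ?_ fun k => ?_
  · have : Nontrivial H := ⟨1, 0, fun h0 => one_ne_zero (α := K) <| by
      rw [← Bialgebra.counit_one (R := K) (A := H), h0, map_zero]⟩
    exact Module.finrank_pos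
  · have := h _ (isBasicInvariant_sum hab (2 * k))
    rwa [sum_lam_mul_lam hS hab] at this

end Kaplansky

end FinHopf

theorem theorem1p8 {K : Type u} [Field K] [IsAlgClosed K] [CharZero K]
    {H : Type v} [Ring H] [HopfAlgebra K H] [FiniteDimensional K H] [IsSemisimpleRing H] :
    (∀ x : H, IsNormalizedIntegral K H x ↔ x = ell K H) ∧
    (∀ f : HopfDual K H, IsNormalizedIntegral K (HopfDual K H) f ↔ f = lam K H) ∧
    COneFormula K H ∧
    COneFormula K (HopfDual K H) ∧
    ((∀ n : ℕ, ∃ z : ℤ, lam K H (cOne K H ^ n) = (z : K)) →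
      IrrepDimsDvd.{u, v, w} K H (Module.finrank K H)) ∧
    ((∀ n : ℕ, ∃ z : ℤ, lam K (HopfDual K H) (cOne K (HopfDual K H) ^ n) = (z : K)) →
      IrrepDimsDvd.{u, max u v, w} K (HopfDual K H) (Module.finrank K H)) ∧
    ((∀ a : K, IsBasicInvariant K H a → IsIntegral ℤ a) →
      IrrepDimsDvd.{u, v, w} K H (Module.finrank K H) ∧
      IrrepDimsDvd.{u, max u v, w} K (HopfDual K H) (Module.finrank K H)) := by
  obtain ⟨hss, hS⟩ := FinHopf.larson_radford (K := K) (H := H)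
  refine ⟨fun x => ⟨fun hx => ?_, ?_⟩, fun f => ⟨fun hf => ?_, ?_⟩, FinHopf.cOneFormula,
    FinHopf.cOneFormula, FinHopf.irrepDimsDvd_of_lam_cOne, fun h => ?_, fun h => ⟨?_, ?_⟩⟩
  · exact FinHopf.IsNormalizedIntegral.eq hx (FinHopf.isNormalizedIntegral_ell hS)
  · rintro rfl
    exact FinHopf.isNormalizedIntegral_ell hS
  · exact FinHopf.IsNormalizedIntegral.eq hf (FinHopf.isNormalizedIntegral_lam hS)
  · rintro rfl
    exact FinHopf.isNormalizedIntegral_lam hS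
  · rw [← FinHopf.finrank_hopfDual]
    exact FinHopf.irrepDimsDvd_of_lam_cOne h
  · exact FinHopf.irrepDimsDvd_of_isBasicInvariant h
  · rw [← FinHopf.finrank_hopfDual]
    exact FinHopf.irrepDimsDvd_of_isBasicInvariant fun a ha =>
      h a (FinHopf.isBasicInvariant_of_hopfDual ha)
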